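/- Let $a\in C^3[0,1]$ and $b\in C^2[0,1]$ be real-valued, and write $\langle f\rangle=\int_0^1 f(x)\,dx$. A number $\lambda\in\mathbb C$ is an eigenvalue if $$u''-(\lambda^2+2\lambda a-b)u=0 \ \text{ on } (0,1),\qquad u(0)=u(1)=0,$$ has a solution $u\in C^2[0,1]$, $u\not\equiv0$; its multiplicity is its order as a zero of the entire function $\lambda\mapsto u(1,\lambda)$, where $u(\cdot,\lambda)$ solves the equation with $u(0,\lambda)=0$, $u'(0,\lambda)=1$. 1. Let $(\lambda_n)_{n\in\mathbb Z\setminus\{0\}}$ be any numbering of the eigenvalues, each repeated according to its multiplicity, such that $\operatorname{Im}\lambda_n$ is nondecreasing in $n$ and $\lambda_{-n}=\overline{\lambda_n}$ whenever $\lambda_n\notin\mathbb R$. Then there are $c_0,c_1\in\mathbb C$ with $$\lambda_n=\pi n\mathrm i+c_0+c_1n^{-1}+O(n^{-2}),\qquad n\to\pm\infty ,$$ and for any such $c_0,c_1$ the function $a$ is constant on $[0,1]$ if and only if $$c_0^2=2\pi\mathrm i\,c_1-\langle b\rangle,$$ in which case $a\equiv-c_0$ on $[0,1]$. 2. Consequently,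 the spectrum of a constant damping determines the damping: if $\alpha\in\mathbb R$ and the set of eigenvalues for the pair $(a,b)$ coincides with the set of eigenvalues for the pair $(\alpha,b)$, then $a\equiv\alpha$ on $[0,1]$. -/

import Mathlib

namespace DampedWave

open Set Filter Asymptotics

/-- `IsSolution a b z u v` says that on `[0,1]` the function `u` is twice differentiable (one-sidedly
at the end points), `v = u'`, and `u'' - (z² + 2 z a - b) u = 0`. For continuous `a`, `b` such
a `u` is automatically of class `C²` on `[0,1]`. -/
structure IsSolution (a b : ℝ → ℝ) (z : ℂ) (u v : ℝ → ℂ) : Prop where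
  deriv_fst : ∀ x ∈ Icc (0 : ℝ) 1, HasDerivWithinAt u (v x) (Icc 0 1) x
  deriv_snd : ∀ x ∈ Icc (0 : ℝ) 1,
    HasDerivWithinAt v ((z ^ 2 + 2 * z * (a x : ℂ) - (b x : ℂ)) * u x) (Icc 0 1) x

/-- `z` is an eigenvalue of `u'' - (z² + 2 z a - b) u = 0` on `(0,1)`, `u(0) = u(1) = 0`:
there is a solution that does not vanish identically. -/
def IsEigenvalue (a b : ℝ → ℝ) (z : ℂ) : Prop :=
  ∃ u v : ℝ → ℂ, IsSolution a b z u v ∧ u 0 = 0 ∧ u 1 = 0 ∧ ∃ x ∈ Icc (0 : ℝ) 1, u x ≠ 0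

open Classical in
/-- The characteristic function `z ↦ u(1, z)`, where `u(·, z)` is the solution with
`u(0, z) = 0`, `u'(0, z) = 1`. For continuous `a`, `b` this solution exists and is
unique on `[0,1]`, so that the second branch is never used; the characteristic function is entire
and its zeros are the eigenvalues. -/
noncomputable def charFun (a b : ℝ → ℝ) (z : ℂ) : ℂ :=
  if h : ∃ u v : ℝ → ℂ, IsSolution a b z u v ∧ u 0 = 0 ∧ v 0 = 1 then h.choose 1 else 0

/-- `lam n`, for `n ≠ 0`, is a numbering of the eigenvalues: each is repeated according to its
algebraic multiplicity (its order as a zero of the characteristic function), the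
imaginary parts are nondecreasing in `n`, and `lam (-n)` is the complex conjugate of `lam n`
whenever `lam n` is not real. The value `lam 0` plays no role. -/
structure IsNumbering (a b : ℝ → ℝ) (lam : ℤ → ℂ) : Prop where
  range_eq : ∀ z : ℂ, (∃ n : ℤ, n ≠ 0 ∧ lam n = z) ↔ IsEigenvalue a b z
  multiplicity : ∀ z : ℂ,
    {n : ℤ | n ≠ 0 ∧ lam n = z}.encard = analyticOrderAt (charFun a b) z
  ordered : ∀ m n : ℤ, m ≠ 0 → n ≠ 0 → m ≤ n → (lam m).im ≤ (lam n).im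
  conj : ∀ n : ℤ, n ≠ 0 → (lam n).im ≠ 0 → lam (-n) = (starRingEnd ℂ) (lam n)

/-- `lam n = π n i + ∑_{j < m} c j n^{-j} + O(n^{-m})` as `n → ±∞`. -/
def HasExpansion (lam : ℤ → ℂ) (m : ℕ) (c : ℕ → ℂ) : Prop :=
  (fun n : ℤ => lam n - ((Real.pi : ℂ) * (n : ℂ) * Complex.I
      + ∑ j ∈ Finset.range m, c j * ((n : ℂ) ^ j)⁻¹))
    =O[atBot ⊔ atTop] (fun n : ℤ => ((n : ℝ) ^ m)⁻¹)

/-- The mean value `⟨f⟩ = ∫₀¹ f(x) dx`. -/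
noncomputable def mean (f : ℝ → ℝ) : ℝ := ∫ x in (0 : ℝ)..1, f x

/-- `f` is constant on `[0,1]`. -/
def IsConstant (f : ℝ → ℝ) : Prop := ∃ k : ℝ, ∀ x ∈ Icc (0 : ℝ) 1, f x = k

end DampedWave

/-! Write q = z² + 2za - b and let Δ be the characteristic function. With P = z + a - (a² + b)/(2z)
one has P² = q + O(1/z), so for large |z| the Liouville–Green functions exp(±∫P - ½∫P'/P) almost
solve u'' = qu. Perturbing about them (`norm_sub_sinh_le`, `charFun_asymptotics`) gives z Δ(z) m(z)
= sinh φ(z) + O(exp|Re z| / |z|²), where m = 1 + O(1/z) and φ(z) = z + ⟨a⟩ - ⟨a² + b⟩/(2z) is the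
`phase`. Since |sinh| dominates the exponential times the truncated distance to πiℤ, each large
eigenvalue satisfies φ(λ) = kπi + O(|λ|⁻²) for some integer k (`exists_int_norm_phase_sub_le`).

It remains to show that k is the index n. Rouché's theorem, comparing zΔ(z) with sinh(z + ⟨a⟩),
counts exactly 2N eigenvalues in the disc of centre -⟨a⟩ and radius π(N + 1/2)
(`zeroCount_charFun`). Ordering by imaginary part and conjugation symmetry then force these to carry
the indices 0 < |n| ≤ N (`IsNumbering.abs_im_lt_iff`), which pins down k
(`IsNumbering.norm_phase_sub_le`).

Solving φ(λ_n) = nπi + O(n⁻²) gives c₀ = -⟨a⟩ and c₁ = ⟨a² + b⟩/(2πi). The identity in question thus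
says ⟨a⟩² = ⟨a²⟩: the variance of a vanishes. The second claim needs no numbering: at a common
eigenvalue the phases of the two pairs differ by almost an element of πiℤ, and letting |λ| → ∞ along
such eigenvalues equates first ⟨a⟩, then ⟨a² + b⟩ (`means_eq_of_common_zeros`). -/

namespace DampedWave

open Set Filter Asymptotics Topology Metric

/-! ### Argument principle and Rouché's theorem for entire functions on discs. -/

section ZeroCounting

variable {f g : ℂ → ℂ} {c : ℂ} {R : ℝ}

theorem finite_zeros_inter_compact (hf : Differentiable ℂ f) {x : ℂ} (hx : f x ≠ 0) {K : Set ℂ}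
    (hK : IsCompact K) : (K ∩ f ⁻¹' {0}).Finite := by
  have h := AnalyticOnNhd.preimage_zero_mem_codiscrete (f := f) (x := x)
    (fun z _ => hf.analyticAt z) hx
  have h2 : (f ⁻¹' {0})ᶜ ∈ codiscreteWithin K :=
    codiscreteWithin_mono (subset_univ K) h
  have h3 := hK.finite_sdiff_of_mem_codiscreteWithin h2
  rwa [sdiff_compl] at h3

theorem analyticOrderAt_ne_top_of_entire (hf : Differentiable ℂ f) {x : ℂ} (hx : f x ≠ 0) (z : ℂ) :
    analyticOrderAt f z ≠ ⊤ := by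
  intro h
  have h1 := (AnalyticOnNhd.analyticOrderAt_eq_top_iff_eq_zero z
    (fun z => hf.analyticAt z)).1 h
  exact hx (congrFun h1 x)

/-- The order gives only a local factorisation; dividing out one factor at a time with `dslope`
keeps the cofactor entire. -/
theorem exists_eq_pow_mul_of_order (w : ℂ) (n : ℕ) :
    ∀ f : ℂ → ℂ, Differentiable ℂ f → analyticOrderAt f w = n →
      ∃ g : ℂ → ℂ, Differentiable ℂ g ∧ (∀ z, f z = (z - w) ^ n * g z) ∧ g w ≠ 0 := by
  induction n with
  | zero =>
    intro f hf h
    refine ⟨f, hf, by simp, ?_⟩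
    exact (hf.analyticAt w).analyticOrderAt_eq_zero.1 (by simpa using h)
  | succ n ih =>
    intro f hf h
    have hfw : f w = 0 := apply_eq_zero_of_analyticOrderAt_ne_zero (by rw [h]; simp)
    have hd : Differentiable ℂ (dslope f w) := by
      rw [← differentiableOn_univ]
      exact (Complex.differentiableOn_dslope univ_mem).2 hf.differentiableOn
    have hfd : ∀ z, f z = (z - w) * dslope f w z := fun z => by
      have := sub_smul_dslope f w z
      rw [hfw, sub_zero, smul_eq_mul] at this
      exact this.symm
    have hmul : analyticOrderAt f w = 1 + analyticOrderAt (dslope f w) w := by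
      have h1 : f = (fun z => z - w) * dslope f w := funext hfd
      conv_lhs => rw [h1]
      rw [analyticOrderAt_mul (by fun_prop) (hd.analyticAt w)]
      congr 1
      exact AnalyticAt.analyticOrderAt_eq_one_of_zero_deriv_ne_zero (by fun_prop) (by simp)
        (by simp)
    have hord : analyticOrderAt (dslope f w) w = n := by
      rw [h, Nat.cast_succ, add_comm] at hmul
      exact (WithTop.add_left_inj ENat.one_ne_top).1 hmul.symm
    obtain ⟨g, hg, hfg, hgw⟩ := ih _ hd hord
    exact ⟨g, hg, fun z => by rw [hfd z, hfg z]; ring, hgw⟩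

theorem exists_eq_prod_mul (hf : Differentiable ℂ f) {x : ℂ} (hx : f x ≠ 0) (Z : Finset ℂ) :
    ∃ g : ℂ → ℂ, Differentiable ℂ g ∧
      (∀ z, f z = (∏ w ∈ Z, (z - w) ^ analyticOrderNatAt f w) * g z) ∧ ∀ w ∈ Z, g w ≠ 0 := by
  classical
  induction Z using Finset.induction_on with
  | empty => exact ⟨f, hf, by simp, by simp⟩
  | insert w Z hw ih =>
    obtain ⟨g, hg, hfg, hgZ⟩ := ih
    have hp : AnalyticAt ℂ (fun z => ∏ w ∈ Z, (z - w) ^ analyticOrderNatAt f w) w := by fun_prop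
    have hord : analyticOrderAt g w = analyticOrderNatAt f w := by
      rw [Nat.cast_analyticOrderNatAt (analyticOrderAt_ne_top_of_entire hf hx w)]
      have h1 : f = (fun z => ∏ w ∈ Z, (z - w) ^ analyticOrderNatAt f w) * g := funext hfg
      conv_rhs => rw [h1, analyticOrderAt_mul hp (hg.analyticAt w)]
      rw [hp.analyticOrderAt_eq_zero.2, zero_add]
      rw [Finset.prod_ne_zero_iff]
      intro v hv
      refine pow_ne_zero _ (sub_ne_zero.2 ?_)
      rintro rfl
      exact hw hv
    obtain ⟨k, hk, hgk, hkw⟩ := exists_eq_pow_mul_of_order w _ g hg hord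
    refine ⟨k, hk, fun z => ?_, ?_⟩
    · rw [hfg z, hgk z, Finset.prod_insert hw]; ring
    · intro v hv
      rcases Finset.mem_insert.1 hv with rfl | hv
      · exact hkw
      · have := hgZ v hv
        rw [hgk v] at this
        exact right_ne_zero_of_mul this

/-- The number of zeros of `f` in the open disc of centre `c` and radius `R`, counted with
multiplicity. -/
noncomputable def zeroCount (f : ℂ → ℂ) (c : ℂ) (R : ℝ) : ℕ :=
  ∑ᶠ z ∈ ball c R, analyticOrderNatAt f z

theorem zeroCount_eq_sum {Z : Finset ℂ}
    (hZ : ∀ z, z ∈ Z ↔ z ∈ ball c R ∧ f z = 0) :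
    zeroCount f c R = ∑ z ∈ Z, analyticOrderNatAt f z := by
  apply finsum_mem_eq_sum_of_inter_support_eq
  ext z
  simp only [mem_inter_iff, Function.mem_support, Finset.mem_coe, hZ]
  constructor
  · rintro ⟨h1, h2⟩
    exact ⟨⟨h1, apply_eq_zero_of_analyticOrderNatAt_ne_zero h2⟩, h2⟩
  · rintro ⟨⟨h1, -⟩, h2⟩
    exact ⟨h1, h2⟩

/-- Dividing out the finitely many zeros in the closed disc splits the logarithmic derivative into
simple poles, whose residues are the orders, and `logDeriv g`, which is holomorphic on the closed
disc and integrates to zero. -/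
theorem circleIntegral_logDeriv (hf : Differentiable ℂ f) (hR : 0 < R)
    (hs : ∀ z ∈ sphere c R, f z ≠ 0) :
    ∮ z in C(c, R), logDeriv f z = 2 * Real.pi * Complex.I * zeroCount f c R := by
  classical
  obtain ⟨x, hxs⟩ : (sphere c R).Nonempty := NormedSpace.sphere_nonempty.2 hR.le
  have hx := hs x hxs
  have hfin := finite_zeros_inter_compact hf hx (isCompact_closedBall c R)
  set Z := hfin.toFinset with hZdef
  have hZ : ∀ z, z ∈ Z ↔ z ∈ ball c R ∧ f z = 0 := by
    intro z
    simp only [hZdef, Finite.mem_toFinset, mem_inter_iff, mem_preimage, mem_singleton_iff]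
    constructor
    · rintro ⟨h1, h2⟩
      refine ⟨?_, h2⟩
      rw [← ball_union_sphere] at h1
      exact h1.resolve_right fun h => hs z h h2
    · rintro ⟨h1, h2⟩
      exact ⟨ball_subset_closedBall h1, h2⟩
  obtain ⟨g, hg, hfg, hgZ⟩ := exists_eq_prod_mul hf hx Z
  have hg0 : ∀ z ∈ closedBall c R, g z ≠ 0 := by
    intro z hz h0
    have hfz : f z = 0 := by rw [hfg z, h0, mul_zero]
    have : z ∈ Z := by
      rw [hZdef, Finite.mem_toFinset]; exact ⟨hz, hfz⟩
    exact hgZ z this h0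
  have hne : ∀ z ∈ sphere c R, ∀ w ∈ Z, z - w ≠ 0 := by
    intro z hz w hw h
    rw [sub_eq_zero] at h
    subst h
    exact hs z hz ((hZ z).1 hw).2
  have hlog : ∀ z ∈ sphere c R, logDeriv f z =
      (∑ w ∈ Z, (analyticOrderNatAt f w : ℂ) * (z - w)⁻¹) + logDeriv g z := by
    intro z hz
    have h1 : f = fun z => (∏ w ∈ Z, (z - w) ^ analyticOrderNatAt f w) * g z := funext hfg
    conv_lhs => rw [h1]
    rw [logDeriv_mul, logDeriv_prod]
    · congr 1
      refine Finset.sum_congr rfl fun w _ => ?_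
      rw [logDeriv_fun_pow (by fun_prop), logDeriv_apply]
      simp
    · exact fun w hw => pow_ne_zero _ (hne z hz w hw)
    · intro w _; fun_prop
    · exact Finset.prod_ne_zero_iff.2 fun w hw => pow_ne_zero _ (hne z hz w hw)
    · exact hg0 z (sphere_subset_closedBall hz)
    · fun_prop
    · exact hg z
  have hgl : DifferentiableOn ℂ (logDeriv g) (closedBall c R) := by
    intro z hz
    have h1 : DifferentiableAt ℂ (deriv g) z := (hg.analyticAt z).deriv.differentiableAt
    exact (h1.div (hg z) (hg0 z hz)).differentiableWithinAt
  have hint : ∀ w ∈ Z, CircleIntegrable (fun z => (analyticOrderNatAt f w : ℂ) * (z - w)⁻¹) c R := by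
    intro w hw
    apply ContinuousOn.circleIntegrable hR.le
    exact continuousOn_const.mul ((continuousOn_id.sub continuousOn_const).inv₀
      fun z hz => hne z hz w hw)
  rw [circleIntegral.integral_congr hR.le hlog, circleIntegral.integral_add
      (CircleIntegrable.fun_sum Z hint)
      ((hgl.continuousOn.mono sphere_subset_closedBall).circleIntegrable hR.le),
    circleIntegral.integral_fun_sum hint]
  have hz : ∮ z in C(c, R), logDeriv g z = 0 :=
    Complex.circleIntegral_eq_zero_of_differentiable_on_off_countable hR.le countable_empty
      hgl.continuousOn fun z hz =>
        (hgl z (ball_subset_closedBall hz.1)).differentiableAt (closedBall_mem_nhds_of_mem hz.1)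
  rw [hz, add_zero, zeroCount_eq_sum hZ, Nat.cast_sum, Finset.mul_sum]
  refine Finset.sum_congr rfl fun w hw => ?_
  rw [circleIntegral.integral_const_mul,
    circleIntegral.integral_sub_inv_of_mem_ball ((hZ w).1 hw).1]
  ring

/-- Rouché's theorem for entire functions on discs. -/
theorem zeroCount_eq_of_norm_sub_lt (hf : Differentiable ℂ f) (hg : Differentiable ℂ g)
    (hR : 0 < R) (h : ∀ z ∈ sphere c R, ‖f z - g z‖ < ‖g z‖) :
    zeroCount f c R = zeroCount g c R := by
  have hg0 : ∀ z ∈ sphere c R, g z ≠ 0 := fun z hz h0 => by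
    have := h z hz
    rw [h0, norm_zero] at this
    exact absurd this (not_lt.2 (norm_nonneg _))
  have hf0 : ∀ z ∈ sphere c R, f z ≠ 0 := fun z hz h0 => by
    have := h z hz
    rw [h0, zero_sub, norm_neg] at this
    exact lt_irrefl _ this
  have hslit : ∀ z ∈ sphere c R, f z / g z ∈ Complex.slitPlane := by
    intro z hz
    have h1 : ‖f z / g z - 1‖ < 1 := by
      rw [div_sub_one (hg0 z hz), norm_div, div_lt_one (norm_pos_iff.2 (hg0 z hz))]
      exact h z hz
    left
    have h2 := (Complex.abs_re_le_norm (f z / g z - 1)).trans_lt h1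
    rw [abs_lt, Complex.sub_re, Complex.one_re] at h2
    linarith [h2.1]
  -- On the circle f/g stays within distance 1 of 1, so the principal branch of log (f/g) is a
  -- primitive of the integrand.
  have key : ∮ z in C(c, R), (logDeriv f z - logDeriv g z) = 0 := by
    apply circleIntegral.integral_eq_zero_of_hasDerivWithinAt'
      (f := fun z => Complex.log (f z / g z))
    rw [abs_of_pos hR]
    intro z hz
    have h1 : HasDerivAt (fun z => f z / g z) (deriv (fun z => f z / g z) z) z :=
      ((hf z).div (hg z) (hg0 z hz)).hasDerivAt
    have h2 := (h1.clog (hslit z hz)).hasDerivWithinAt (s := sphere c R)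
    rw [← logDeriv_apply (fun z => f z / g z), logDeriv_div z (hf0 z hz) (hg0 z hz)
      (hf z) (hg z)] at h2
    exact h2
  have hci : ∀ {k : ℂ → ℂ}, Differentiable ℂ k → (∀ z ∈ sphere c R, k z ≠ 0) →
      CircleIntegrable (logDeriv k) c R := by
    intro k hk hk0
    apply ContinuousOn.circleIntegrable hR.le
    intro z hz
    have h1 : DifferentiableAt ℂ (deriv k) z := (hk.analyticAt z).deriv.differentiableAt
    exact (h1.div (hk z) (hk0 z hz)).continuousAt.continuousWithinAt
  rw [circleIntegral.integral_sub (hci hf hf0) (hci hg hg0), circleIntegral_logDeriv hf hR hf0,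
    circleIntegral_logDeriv hg hR hg0, ← mul_sub, mul_eq_zero] at key
  have h3 := sub_eq_zero.1 (key.resolve_left Complex.two_pi_I_ne_zero)
  exact_mod_cast h3

/-- Rouché's theorem is applied to z times the characteristic function; this removes the spurious
zero at the origin, whether or not f vanishes there too. -/
theorem zeroCount_id_mul (hf : Differentiable ℂ f) {x : ℂ} (hx : f x ≠ 0) (h0 : 0 ∈ ball c R) :
    zeroCount (fun z => z * f z) c R = zeroCount f c R + 1 := by
  classical
  have hfin := finite_zeros_inter_compact hf hx (isCompact_closedBall c R)
  have hfin' : (ball c R ∩ f ⁻¹' {0}).Finite :=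
    hfin.subset (inter_subset_inter_left _ ball_subset_closedBall)
  have hord : ∀ z, analyticOrderNatAt (fun z => z * f z) z =
      (if z = 0 then 1 else 0) + analyticOrderNatAt f z := by
    intro z
    have hid : analyticOrderAt (id : ℂ → ℂ) z = ((if z = 0 then 1 else 0 : ℕ) : ℕ∞) := by
      split_ifs with h
      · subst h; simp
      · rw [(analyticAt_id).analyticOrderAt_eq_zero.2 h]; simp
    have h1 : (fun z => z * f z) = id * f := rfl
    rw [h1, analyticOrderNatAt_mul analyticAt_id (hf.analyticAt z) (by rw [hid]; exact ENat.natCast_ne_top _)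
      (analyticOrderAt_ne_top_of_entire hf hx z)]
    congr 1
    rw [analyticOrderNatAt, hid]
    rfl
  have hZ : ∀ z, z ∈ hfin'.toFinset ↔ z ∈ ball c R ∧ f z = 0 := by simp
  have hZ' : ∀ z, z ∈ insert 0 hfin'.toFinset ↔ z ∈ ball c R ∧ z * f z = 0 := by
    intro z
    simp only [Finset.mem_insert, hZ, mul_eq_zero]
    constructor
    · rintro (rfl | h)
      · exact ⟨h0, Or.inl rfl⟩
      · exact ⟨h.1, Or.inr h.2⟩
    · rintro ⟨h1, h2 | h2⟩
      · exact Or.inl h2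
      · exact Or.inr ⟨h1, h2⟩
  rw [zeroCount_eq_sum hZ', zeroCount_eq_sum hZ]
  simp_rw [hord]
  rw [Finset.sum_add_distrib, add_comm]
  congr 1
  · by_cases h : (0 : ℂ) ∈ hfin'.toFinset
    · rw [Finset.insert_eq_of_mem h]
    · rw [Finset.sum_insert h, Nat.add_eq_right, analyticOrderNatAt,
        (hf.analyticAt 0).analyticOrderAt_eq_zero.2]
      · rfl
      · intro hf0
        exact h ((hZ 0).2 ⟨h0, hf0⟩)
  · rw [Finset.sum_ite_eq' (insert 0 hfin'.toFinset) (0 : ℂ) (fun _ => 1)]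
    simp

/-- The indices are partitioned into the fibres of `lam` over the finitely many zeros in the disc,
so a count of zeros becomes a count of indices. -/
theorem encard_eq_zeroCount {ι : Type*} (hf : Differentiable ℂ f) {x : ℂ} (hx : f x ≠ 0)
    {s : Set ι} {lam : ι → ℂ}
    (h : ∀ z, {i | i ∈ s ∧ lam i = z}.encard = analyticOrderAt f z) :
    {i | i ∈ s ∧ lam i ∈ ball c R}.encard = zeroCount f c R := by
  classical
  have hfin := finite_zeros_inter_compact hf hx (isCompact_closedBall c R)
  have hfin' : (ball c R ∩ f ⁻¹' {0}).Finite :=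
    hfin.subset (inter_subset_inter_left _ ball_subset_closedBall)
  have hZ : ∀ z, z ∈ hfin'.toFinset ↔ z ∈ ball c R ∧ f z = 0 := by simp
  have hcard : ∀ z, {i | i ∈ s ∧ lam i = z}.encard = analyticOrderNatAt f z := fun z => by
    rw [h z, Nat.cast_analyticOrderNatAt (analyticOrderAt_ne_top_of_entire hf hx z)]
  have hz0 : ∀ i ∈ s, f (lam i) = 0 := by
    intro i hi
    apply apply_eq_zero_of_analyticOrderAt_ne_zero
    rw [← h (lam i)]
    exact encard_ne_zero.2 ⟨i, hi, rfl⟩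
  have hfib : ∀ z, {i | i ∈ s ∧ lam i = z}.Finite := fun z => by
    rw [← encard_ne_top_iff, hcard z]; simp
  have hU : {i | i ∈ s ∧ lam i ∈ ball c R} =
      ((hfin'.toFinset.biUnion fun z => (hfib z).toFinset : Finset ι) : Set ι) := by
    ext i
    simp only [mem_ofPred_eq, Finset.mem_coe, Finset.mem_biUnion, hZ, Finite.mem_toFinset]
    constructor
    · rintro ⟨h1, h2⟩
      exact ⟨lam i, ⟨h2, hz0 i h1⟩, h1, rfl⟩
    · rintro ⟨z, ⟨h1, -⟩, h2, rfl⟩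
      exact ⟨h2, h1⟩
  rw [hU, encard_coe_eq_coe_finsetCard, Finset.card_biUnion, zeroCount_eq_sum hZ]
  · congr 1
    refine Finset.sum_congr rfl fun z _ => ?_
    have := hcard z
    rw [(hfib z).encard_eq_coe_toFinset_card] at this
    exact_mod_cast this
  · intro z _ w _ hzw
    refine Finset.disjoint_left.2 fun i hi hi' => hzw ?_
    simp only [Finite.mem_toFinset, mem_ofPred_eq] at hi hi'
    exact hi.2.symm.trans hi'.2

end ZeroCounting

/-! ### Lower bounds and zeros of the hyperbolic sine. -/

section Sinh

theorem norm_sinh_sq (z : ℂ) : ‖Complex.sinh z‖ ^ 2 = Real.sinh z.re ^ 2 + Real.sin z.im ^ 2 := by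
  conv_lhs => rw [← Complex.re_add_im z]
  rw [Complex.sinh_add, Complex.sinh_mul_I, Complex.cosh_mul_I, ← Complex.ofReal_sinh,
    ← Complex.ofReal_cosh, ← Complex.ofReal_sin, ← Complex.ofReal_cos, ← mul_assoc,
    ← Complex.ofReal_mul, ← Complex.ofReal_mul, ← Complex.normSq_eq_norm_sq, Complex.normSq_add_mul_I]
  have h1 := Real.cosh_sq z.re
  have h2 := Real.sin_sq_add_cos_sq z.im
  nlinarith [h1, h2]

theorem norm_sinh_sub_int_mul (z : ℂ) (k : ℤ) :
    ‖Complex.sinh (z - k * Real.pi * Complex.I)‖ = ‖Complex.sinh z‖ := by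
  rw [← sq_eq_sq₀ (norm_nonneg _) (norm_nonneg _), norm_sinh_sq, norm_sinh_sq]
  have h1 : (z - k * Real.pi * Complex.I).re = z.re := by simp
  have h2 : (z - k * Real.pi * Complex.I).im = z.im - k * Real.pi := by simp
  rw [h1, h2, Real.sin_sub_int_mul_pi]
  congr 1
  rw [mul_pow]
  have : ((-1 : ℝ) ^ k) ^ 2 = 1 := by
    rcases Int.even_or_odd k with h | h
    · rw [h.neg_one_zpow]; norm_num
    · rw [h.neg_one_zpow]; norm_num
  rw [this, one_mul]

/-- For |Re z| ≥ 1 the real part alone gives the exponential. Otherwise the exponential is at most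
3, and |x| ≤ |sinh x| with Jordan's inequality |sin y| ≥ 2|y|/π bounds |sinh z| below by |z|/2. -/
theorem min_norm_one_mul_exp_le_norm_sinh {z : ℂ} (hz : |z.im| ≤ Real.pi / 2) :
    min ‖z‖ 1 * Real.exp |z.re| ≤ 6 * ‖Complex.sinh z‖ := by
  have hsq := norm_sinh_sq z
  have hre : |Real.sinh z.re| ≤ ‖Complex.sinh z‖ := by
    apply abs_le_of_sq_le_sq _ (norm_nonneg _)
    rw [hsq]; nlinarith [sq_nonneg (Real.sin z.im)]
  by_cases h1 : 1 ≤ |z.re|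
  · have h2 : Real.sinh |z.re| = |Real.sinh z.re| := by
      rw [← Real.abs_sinh]
    rw [← h2, Real.sinh_eq] at hre
    have h3 : Real.exp (-|z.re|) ≤ 1 := Real.exp_le_one_iff.2 (by linarith)
    have h4 : (2 : ℝ) ≤ Real.exp |z.re| := by
      have := Real.add_one_le_exp |z.re|
      linarith
    have h5 : min ‖z‖ 1 * Real.exp |z.re| ≤ 1 * Real.exp |z.re| := by gcongr; exact min_le_right _ _
    linarith
  · push Not at h1
    have h2 : |z.re| ≤ |Real.sinh z.re| := by
      rw [Real.abs_sinh]
      exact Real.self_le_sinh_iff.2 (abs_nonneg _)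
    have h3 : 2 / Real.pi * |z.im| ≤ |Real.sin z.im| := Real.mul_abs_le_abs_sin hz
    have hpi : 2 / Real.pi ≥ 1 / 2 := by
      rw [ge_iff_le, div_le_div_iff₀ (by norm_num) Real.pi_pos]
      linarith [Real.pi_le_four]
    have h4 : 1 / 2 * |z.im| ≤ |Real.sin z.im| :=
      (mul_le_mul_of_nonneg_right hpi (abs_nonneg _)).trans h3
    have h5 : 1 / 2 * ‖z‖ ≤ ‖Complex.sinh z‖ := by
      rw [← sq_le_sq₀ (by positivity) (norm_nonneg _), hsq, mul_pow, ← Complex.normSq_eq_norm_sq,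
        Complex.normSq_apply]
      have e1 : z.re ^ 2 ≤ Real.sinh z.re ^ 2 := sq_le_sq.2 h2
      have e2 : (1 / 2 * z.im) ^ 2 ≤ Real.sin z.im ^ 2 := by
        apply sq_le_sq.2
        rw [abs_mul, abs_of_pos (by norm_num : (0 : ℝ) < 1 / 2)]
        exact h4
      nlinarith [sq_nonneg z.re]
    have h6 : Real.exp |z.re| ≤ 3 := by
      have := Real.exp_le_exp.2 h1.le
      linarith [Real.exp_one_lt_three]
    have h7 : min ‖z‖ 1 * Real.exp |z.re| ≤ ‖z‖ * 3 := by
      gcongr; exact min_le_left _ _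
    linarith

theorem exists_int_min_mul_exp_le_norm_sinh (z : ℂ) :
    ∃ k : ℤ, min ‖z - k * Real.pi * Complex.I‖ 1 * Real.exp |z.re| ≤ 6 * ‖Complex.sinh z‖ := by
  refine ⟨round (z.im / Real.pi), ?_⟩
  set k := round (z.im / Real.pi)
  have h := min_norm_one_mul_exp_le_norm_sinh (z := z - k * Real.pi * Complex.I) (by
    have h1 := abs_sub_round (z.im / Real.pi)
    have h2 : (z - k * Real.pi * Complex.I).im = (z.im / Real.pi - k) * Real.pi := by
      have := Real.pi_ne_zero
      simp; field_simp
    rw [h2, abs_mul, abs_of_pos Real.pi_pos]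
    nlinarith [Real.pi_pos])
  rw [norm_sinh_sub_int_mul] at h
  simpa using h

/-- The points of πiℤ have modulus in πℕ, and the radius lies midway between two such moduli. -/
theorem norm_sub_int_mul_pi_ge {w : ℂ} {N : ℕ} (hw : ‖w‖ = Real.pi * (N + 1 / 2)) (k : ℤ) :
    Real.pi / 2 ≤ ‖w - k * Real.pi * Complex.I‖ := by
  have h1 : ‖(k * Real.pi * Complex.I : ℂ)‖ = |(k : ℝ)| * Real.pi := by
    simp [abs_of_pos Real.pi_pos]
  have h2 := abs_norm_sub_norm_le w (k * Real.pi * Complex.I)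
  rw [h1, hw] at h2
  refine le_trans ?_ h2
  have h3 : ((N : ℝ) + 1 / 2 - |(k : ℝ)|) * Real.pi = Real.pi * (N + 1 / 2) - |(k : ℝ)| * Real.pi := by
    ring
  rw [← h3, abs_mul, abs_of_pos Real.pi_pos]
  have h4 : (1 / 2 : ℝ) ≤ abs ((N : ℝ) + 1 / 2 - abs (k : ℝ)) := by
    rw [← Int.cast_abs]
    rcases le_or_gt |k| (N : ℤ) with h | h
    · have : ((|k| : ℤ) : ℝ) ≤ N := by exact_mod_cast h
      rw [abs_of_nonneg (by linarith)]; linarith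
    · have : (N : ℝ) + 1 ≤ ((|k| : ℤ) : ℝ) := by exact_mod_cast h
      rw [abs_of_nonpos (by linarith)]; linarith
  nlinarith [Real.pi_pos]

theorem exp_le_norm_sinh_of_norm_eq {w : ℂ} {N : ℕ} (hw : ‖w‖ = Real.pi * (N + 1 / 2)) :
    Real.exp |w.re| ≤ 6 * ‖Complex.sinh w‖ := by
  obtain ⟨k, hk⟩ := exists_int_min_mul_exp_le_norm_sinh w
  have h := norm_sub_int_mul_pi_ge hw k
  rw [min_eq_right (by linarith [Real.pi_gt_three]), one_mul] at hk
  exact hk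

theorem sinh_eq_zero_iff_exists_int {z : ℂ} :
    Complex.sinh z = 0 ↔ ∃ k : ℤ, z = k * Real.pi * Complex.I := by
  constructor
  · intro h
    obtain ⟨k, hk⟩ := exists_int_min_mul_exp_le_norm_sinh z
    rw [h, norm_zero, mul_zero] at hk
    have h1 := nonpos_of_mul_nonpos_left hk (Real.exp_pos _)
    refine ⟨k, ?_⟩
    rw [← sub_eq_zero, ← norm_le_zero_iff]
    rcases min_le_iff.1 h1 with h2 | h2
    · exact h2
    · norm_num at h2
  · rintro ⟨k, rfl⟩
    rw [← norm_eq_zero, ← norm_sinh_sub_int_mul _ k]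
    simp

theorem zeroCount_sinh (m : ℝ) (N : ℕ) :
    zeroCount (fun z => Complex.sinh (z + m)) (-m : ℂ) (Real.pi * (N + 1 / 2)) = 2 * N + 1 := by
  classical
  have hinj : Function.Injective fun k : ℤ => (k * Real.pi * Complex.I - m : ℂ) := by
    intro k l hkl
    have h1 := congrArg Complex.im hkl
    simp only [Complex.sub_im, Complex.ofReal_im, Complex.mul_I_im] at h1
    have h2 : (k : ℝ) * Real.pi = l * Real.pi := by
      simpa using h1
    exact_mod_cast mul_right_cancel₀ Real.pi_ne_zero h2
  have hd : Differentiable ℂ fun z => Complex.sinh (z + m) := by fun_prop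
  rw [zeroCount_eq_sum (Z := (Finset.Icc (-N : ℤ) N).map ⟨_, hinj⟩)]
  · rw [Finset.sum_congr rfl (g := fun _ => 1), Finset.sum_const, smul_eq_mul, mul_one,
      Finset.card_map, Int.card_Icc]
    · omega
    · intro z hz
      simp only [Finset.mem_map, Function.Embedding.coeFn_mk] at hz
      obtain ⟨k, -, rfl⟩ := hz
      rw [analyticOrderNatAt, AnalyticAt.analyticOrderAt_eq_one_of_zero_deriv_ne_zero
        (hd.analyticAt _)]
      · rfl
      · exact sinh_eq_zero_iff_exists_int.2 ⟨k, by ring⟩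
      · have hder : HasDerivAt (fun z : ℂ => Complex.sinh (z + m))
            (Complex.cosh ((k * Real.pi * Complex.I - m : ℂ) + m)) (k * Real.pi * Complex.I - m) := by
          simpa using ((hasDerivAt_id (k * Real.pi * Complex.I - m : ℂ)).add_const (m : ℂ)).csinh
        rw [hder.deriv]
        have h0 : Complex.sinh ((k * Real.pi * Complex.I - m : ℂ) + m) = 0 :=
          sinh_eq_zero_iff_exists_int.2 ⟨k, by ring⟩
        have h1 := Complex.cosh_sq ((k * Real.pi * Complex.I - m : ℂ) + m)
        rw [h0] at h1
        intro h2
        rw [h2] at h1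
        norm_num at h1
  · intro z
    simp only [Finset.mem_map, Function.Embedding.coeFn_mk, sinh_eq_zero_iff_exists_int,
      Finset.mem_Icc, mem_ball, dist_eq_norm]
    have hnorm : ∀ k : ℤ, ‖(k * Real.pi * Complex.I - m : ℂ) - -m‖ = |(k : ℝ)| * Real.pi := by
      intro k
      have : (k * Real.pi * Complex.I - m : ℂ) - -m = k * Real.pi * Complex.I := by ring
      rw [this]
      simp [abs_of_pos Real.pi_pos]
    constructor
    · rintro ⟨k, hk, rfl⟩
      refine ⟨?_, k, by ring⟩
      rw [hnorm, ← Int.cast_abs]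
      have : ((|k| : ℤ) : ℝ) ≤ N := by exact_mod_cast abs_le.2 hk
      nlinarith [Real.pi_pos]
    · rintro ⟨h1, k, hk⟩
      have hz : z = k * Real.pi * Complex.I - m := by rw [← hk]; ring
      refine ⟨k, ?_, hz.symm⟩
      rw [hz, hnorm, ← Int.cast_abs, mul_comm, mul_lt_mul_iff_right₀ Real.pi_pos] at h1
      have h2 : ((|k| : ℤ) : ℝ) < N + 1 := by linarith
      have h3 : |k| < N + 1 := by exact_mod_cast h2
      exact abs_le.1 (by omega)

end Sinh


/-! ### The initial value problem as a Volterra equation. -/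

section Volterra

/-- The primitive `x ↦ ∫₀ˣ f` of a continuous function on `[0,1]`. -/
noncomputable def primitive (f : C(unitInterval, ℂ)) (x : ℝ) : ℂ :=
  ∫ t in (0 : ℝ)..x, IccExtend zero_le_one f t

theorem continuous_IccExtend_unitInterval (f : C(unitInterval, ℂ)) :
    Continuous (IccExtend (zero_le_one (α := ℝ)) f) :=
  f.continuous.Icc_extend'

theorem hasDerivAt_primitive (f : C(unitInterval, ℂ)) (x : ℝ) :
    HasDerivAt (primitive f) (IccExtend zero_le_one f x) x :=
  ((continuous_IccExtend_unitInterval f).integral_hasStrictDerivAt 0 x).hasDerivAt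

theorem primitive_zero (f : C(unitInterval, ℂ)) : primitive f 0 = 0 := by simp [primitive]

theorem norm_primitive_le_of_norm_le {f : C(unitInterval, ℂ)} {B : ℝ} {n : ℕ}
    (hf : ∀ x : unitInterval, ‖f x‖ ≤ B * ((x : ℝ) ^ n / n.factorial)) (x : unitInterval) :
    ‖primitive f x‖ ≤ B * ((x : ℝ) ^ (n + 1) / (n + 1).factorial) := by
  have hx0 : (0 : ℝ) ≤ x := x.2.1
  have h1 : ‖primitive f x‖ ≤ ∫ t in (0 : ℝ)..x, B * (t ^ n / n.factorial) := by
    apply intervalIntegral.norm_integral_le_of_norm_le hx0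
    · refine Eventually.of_forall fun t ht => ?_
      have htI : t ∈ Icc (0 : ℝ) 1 := ⟨ht.1.le, ht.2.trans x.2.2⟩
      rw [IccExtend_of_mem _ _ htI]
      exact hf ⟨t, htI⟩
    · apply Continuous.intervalIntegrable
      fun_prop
  refine h1.trans_eq ?_
  rw [intervalIntegral.integral_const_mul, intervalIntegral.integral_div, integral_pow,
    Nat.factorial_succ]
  have : (n.factorial : ℝ) ≠ 0 := by positivity
  push_cast
  field_simp
  simp

/-- The integration operator on `C([0,1])`. -/
noncomputable def volterra : C(unitInterval, ℂ) →L[ℂ] C(unitInterval, ℂ) :=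
  LinearMap.mkContinuous
    { toFun := fun f => ⟨fun x => primitive f x,
        (continuous_iff_continuousAt.2 fun x => (hasDerivAt_primitive f x).continuousAt).comp
          continuous_subtype_val⟩
      map_add' := fun f g => by
        ext x
        simp only [primitive, ContinuousMap.coe_mk, ContinuousMap.add_apply]
        rw [← intervalIntegral.integral_add
          ((continuous_IccExtend_unitInterval f).intervalIntegrable _ _)
          ((continuous_IccExtend_unitInterval g).intervalIntegrable _ _)]
        rfl
      map_smul' := fun c f => by
        ext x
        simp only [primitive, ContinuousMap.coe_mk, ContinuousMap.smul_apply, RingHom.id_apply]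
        rw [← intervalIntegral.integral_smul]
        rfl }
    1 (fun f => by
      rw [one_mul]
      refine (ContinuousMap.norm_le _ (norm_nonneg f)).2 fun x => ?_
      have h := norm_primitive_le_of_norm_le (f := f) (B := ‖f‖) (n := 0)
        (fun x => by simpa using f.norm_coe_le_norm x) x
      refine h.trans ?_
      have : (x : ℝ) ≤ 1 := x.2.2
      simp only [zero_add, pow_one, Nat.factorial_one, Nat.cast_one, div_one]
      exact mul_le_of_le_one_right (norm_nonneg _) this)

theorem volterra_apply (f : C(unitInterval, ℂ)) (x : unitInterval) :
    volterra f x = primitive f x := rfl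

/-- The integral operator `f ↦ ∫₀ˣ ∫₀ᵗ q f` of the equation `u'' = q u`. -/
noncomputable def solutionOperator (q : C(unitInterval, ℂ)) :
    C(unitInterval, ℂ) →L[ℂ] C(unitInterval, ℂ) :=
  volterra ∘L volterra ∘L ContinuousLinearMap.mul ℂ C(unitInterval, ℂ) q

theorem solutionOperator_apply (q f : C(unitInterval, ℂ)) :
    solutionOperator q f = volterra (volterra (q * f)) := rfl

/-- Each application of the operator integrates twice, raising the exponent and the factorial by
two. -/
theorem norm_solutionOperator_pow_apply_le (q f : C(unitInterval, ℂ)) (n : ℕ) (x : unitInterval) :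
    ‖(solutionOperator q ^ n) f x‖ ≤
      (‖q‖ ^ n * ‖f‖) * ((x : ℝ) ^ (2 * n) / (2 * n).factorial) := by
  induction n generalizing x with
  | zero => simpa using f.norm_coe_le_norm x
  | succ n ih =>
    rw [pow_succ', mul_apply_eq_comp, solutionOperator_apply]
    refine norm_primitive_le_of_norm_le (f := volterra _) (n := 2 * n + 1) (fun y => ?_) x
    refine norm_primitive_le_of_norm_le (fun t => ?_) y
    rw [ContinuousMap.mul_apply, norm_mul, pow_succ', mul_assoc, mul_assoc]
    have h := ih t
    rw [mul_assoc] at h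
    exact mul_le_mul (q.norm_coe_le_norm t) h (norm_nonneg _) (norm_nonneg _)

/-- 1 - x commutes with the geometric sum, and their product 1 - xⁿ is a unit. Hence no smallness of
the potential is needed: some power of the operator has norm below 1. -/
theorem isUnit_one_sub_of_norm_pow_lt_one {R : Type*} [NormedRing R] [CompleteSpace R] {x : R}
    {n : ℕ} (h : ‖x ^ n‖ < 1) : IsUnit (1 - x) := by
  have h1 : IsUnit (1 - x ^ n) := isUnit_one_sub_of_norm_lt_one h
  rw [← mul_neg_geom_sum] at h1
  refine ((Commute.isUnit_mul_iff ?_).1 h1).1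
  exact Commute.sum_right _ _ _ fun i _ =>
    ((Commute.one_left _).sub_left (Commute.refl _)).pow_right i

theorem isUnit_one_sub_solutionOperator (q : C(unitInterval, ℂ)) :
    IsUnit (1 - solutionOperator q) := by
  have hnorm : ∀ n, ‖solutionOperator q ^ n‖ ≤ ‖q‖ ^ n / n.factorial := by
    intro n
    refine ContinuousLinearMap.opNorm_le_bound _ (by positivity) fun f => ?_
    refine (ContinuousMap.norm_le _ (by positivity)).2 fun x => ?_
    refine (norm_solutionOperator_pow_apply_le q f n x).trans ?_
    have h1 : (x : ℝ) ^ (2 * n) ≤ 1 := pow_le_one₀ x.2.1 x.2.2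
    have h2 : (n.factorial : ℝ) ≤ (2 * n).factorial := by
      exact_mod_cast Nat.factorial_le (by omega)
    have h3 : (x : ℝ) ^ (2 * n) / (2 * n).factorial ≤ 1 / n.factorial := by
      gcongr
    calc _ ≤ (‖q‖ ^ n * ‖f‖) * (1 / n.factorial) := by gcongr
      _ = _ := by ring
  obtain ⟨n, hn⟩ := ((FloorSemiring.tendsto_pow_div_factorial_atTop ‖q‖).eventually
    (gt_mem_nhds one_pos)).exists
  exact isUnit_one_sub_of_norm_pow_lt_one (R := C(unitInterval, ℂ) →L[ℂ] C(unitInterval, ℂ))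
    ((hnorm n).trans_lt hn)

end Volterra

/-! ### The characteristic function is entire and its zeros are the eigenvalues. -/

section CharFun

theorem differentiable_inverse_one_sub {E : Type*} [NormedAddCommGroup E] [NormedSpace ℂ E]
    [CompleteSpace E] {T : ℂ → E →L[ℂ] E} (hT : Differentiable ℂ T) (h : ∀ z, IsUnit (1 - T z)) :
    Differentiable ℂ fun z => Ring.inverse (1 - T z) := fun z =>
  DifferentiableAt.comp (g := Ring.inverse) z (differentiableAt_inverse (h z)) ((hT z).const_sub 1)

theorem differentiable_comp_mul {E : Type*} [NormedCommRing E] [NormedAlgebra ℂ E] {f : ℂ → E}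
    (hf : Differentiable ℂ f) (V : E →L[ℂ] E) :
    Differentiable ℂ fun z => V ∘L ContinuousLinearMap.mul ℂ E (f z) := by
  fun_prop

/-- The restriction to `[0,1]` of a real function as a complex-valued continuous function. -/
noncomputable def restrictIcc (a : ℝ → ℝ) (ha : ContinuousOn a (Icc 0 1)) : C(unitInterval, ℂ) :=
  ⟨fun x => (a x : ℂ), Complex.continuous_ofReal.comp ha.domRestrict⟩

variable {a b : ℝ → ℝ} (ha : ContinuousOn a (Icc 0 1)) (hb : ContinuousOn b (Icc 0 1))

/-- The coefficient `z² + 2 z a - b`. -/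
noncomputable def coefficient (z : ℂ) : C(unitInterval, ℂ) :=
  z ^ 2 • 1 + (2 * z) • restrictIcc a ha - restrictIcc b hb

theorem coefficient_apply (z : ℂ) (x : unitInterval) :
    coefficient ha hb z x = z ^ 2 + 2 * z * (a x : ℂ) - (b x : ℂ) := by
  simp [coefficient, restrictIcc]

/-- The solution with initial values `u(0) = 0`, `u'(0) = 1`. -/
noncomputable def fundamentalSolution (z : ℂ) : C(unitInterval, ℂ) :=
  Ring.inverse (1 - solutionOperator (coefficient ha hb z)) ⟨fun x => ((x : ℝ) : ℂ), by fun_prop⟩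

theorem fundamentalSolution_eq (z : ℂ) (x : unitInterval) :
    fundamentalSolution ha hb z x = ((x : ℝ) : ℂ) +
      solutionOperator (coefficient ha hb z) (fundamentalSolution ha hb z) x := by
  have h1 := Ring.mul_inverse_cancel _ (isUnit_one_sub_solutionOperator (coefficient ha hb z))
  have h2 := DFunLike.congr_fun (DFunLike.congr_fun h1
    (⟨fun x => ((x : ℝ) : ℂ), by fun_prop⟩ : C(unitInterval, ℂ))) x
  rw [mul_apply_eq_comp] at h2
  change (fundamentalSolution ha hb z - solutionOperator (coefficient ha hb z)
    (fundamentalSolution ha hb z)) x = ((x : ℝ) : ℂ) at h2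
  rw [ContinuousMap.sub_apply] at h2
  rw [← h2]; ring

theorem exists_isSolution (z : ℂ) : ∃ u v : ℝ → ℂ, IsSolution a b z u v ∧ u 0 = 0 ∧ v 0 = 1 ∧
    ∀ x : unitInterval, u x = fundamentalSolution ha hb z x := by
  set U := fundamentalSolution ha hb z
  set q := coefficient ha hb z
  have hu : ∀ x : unitInterval, ((x : ℝ) : ℂ) + primitive (volterra (q * U)) x = U x :=
    fun x => (fundamentalSolution_eq ha hb z x).symm
  refine ⟨fun x => x + primitive (volterra (q * U)) x, fun x => 1 + primitive (q * U) x,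
    ⟨fun x hx => ?_, fun x hx => ?_⟩, by simp [primitive_zero], by simp [primitive_zero], hu⟩
  · have h := ((Complex.ofRealCLM.hasDerivAt (x := x)).add
      (hasDerivAt_primitive (volterra (q * U)) x)).hasDerivWithinAt (s := Icc 0 1)
    rw [IccExtend_of_mem _ _ hx] at h
    exact h
  · have h := ((hasDerivAt_primitive (q * U) x).const_add 1).hasDerivWithinAt (s := Icc 0 1)
    rw [IccExtend_of_mem _ _ hx, ContinuousMap.mul_apply, coefficient_apply, ← hu ⟨x, hx⟩] at h
    exact h

theorem sub_eq_primitive {F f : ℝ → ℂ}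
    (hF : ∀ x ∈ Icc (0 : ℝ) 1, HasDerivWithinAt F (f x) (Icc 0 1) x) (g : C(unitInterval, ℂ))
    (hg : ∀ x : unitInterval, g x = f x) (x : unitInterval) : F x - F 0 = primitive g x := by
  have hx0 : (0 : ℝ) ≤ x := x.2.1
  refine (intervalIntegral.integral_eq_sub_of_hasDerivAt_of_le hx0 ?_ ?_
    ((continuous_IccExtend_unitInterval g).intervalIntegrable _ _)).symm
  · exact fun t ht => ((hF t ⟨ht.1, ht.2.trans x.2.2⟩).continuousWithinAt).mono
      (Icc_subset_Icc_right x.2.2)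
  · intro t ht
    have htI : t ∈ Icc (0 : ℝ) 1 := ⟨ht.1.le, ht.2.le.trans x.2.2⟩
    rw [IccExtend_of_mem _ _ htI, hg]
    exact (hF t htI).hasDerivAt (Icc_mem_nhds ht.1 (ht.2.trans_le x.2.2))

/-- Integrating twice turns the equation into (1 - T)u = v(0)x with T the solution operator, and 1 -
T is invertible. This is the uniqueness that makes `charFun` independent of the choice in its
definition. -/
theorem IsSolution.eq_mul_fundamentalSolution {z : ℂ} {u v : ℝ → ℂ} (h : IsSolution a b z u v)
    (hu0 : u 0 = 0) (x : unitInterval) : u x = v 0 * fundamentalSolution ha hb z x := by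
  have hcu : ContinuousOn u (Icc 0 1) := fun x hx => (h.deriv_fst x hx).continuousWithinAt
  have hcv : ContinuousOn v (Icc 0 1) := fun x hx => (h.deriv_snd x hx).continuousWithinAt
  let U : C(unitInterval, ℂ) := ⟨fun x => u x, hcu.domRestrict⟩
  let X : C(unitInterval, ℂ) := ⟨fun x => ((x : ℝ) : ℂ), by fun_prop⟩
  set q := coefficient ha hb z with hq
  have hv : ∀ x : unitInterval, v x = v 0 + volterra (q * U) x := by
    intro x
    have := sub_eq_primitive h.deriv_snd (q * U) (fun y => by
      rw [ContinuousMap.mul_apply, hq, coefficient_apply]; rfl) x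
    rw [volterra_apply, ← this]; ring
  have hu : ∀ x : unitInterval, u x - v 0 * x = solutionOperator q U x := by
    intro x
    have hd : ∀ x ∈ Icc (0 : ℝ) 1, HasDerivWithinAt (fun x : ℝ => u x - v 0 * x) (v x - v 0)
        (Icc 0 1) x := fun x hx => by
      have h1 := (h.deriv_fst x hx).sub
        (((Complex.ofRealCLM.hasDerivAt (x := x)).const_mul (v 0)).hasDerivWithinAt)
      simp only [Complex.ofRealCLM_apply, Complex.ofReal_one, mul_one] at h1
      exact h1
    have := sub_eq_primitive hd (volterra (q * U)) (fun y => by rw [hv y]; ring) x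
    rw [solutionOperator_apply, volterra_apply, ← this, hu0]
    simp
  have hU : (1 - solutionOperator q) U = v 0 • X := by
    ext x
    change u x - solutionOperator q U x = v 0 * x
    rw [← hu]; ring
  have h1 := DFunLike.congr_fun
    (Ring.inverse_mul_cancel _ (isUnit_one_sub_solutionOperator q)) U
  rw [mul_apply_eq_comp, hU, map_smul] at h1
  exact (DFunLike.congr_fun h1 x).symm

theorem charFun_eq (z : ℂ) : charFun a b z = fundamentalSolution ha hb z 1 := by
  have hex : ∃ u v : ℝ → ℂ, IsSolution a b z u v ∧ u 0 = 0 ∧ v 0 = 1 := by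
    obtain ⟨u, v, h1, h2, h3, -⟩ := exists_isSolution ha hb z
    exact ⟨u, v, h1, h2, h3⟩
  rw [charFun, dif_pos hex]
  obtain ⟨v, h1, h2, h3⟩ := hex.choose_spec
  have := h1.eq_mul_fundamentalSolution ha hb h2 1
  rw [h3, one_mul] at this
  exact this

include ha hb in
theorem differentiable_charFun : Differentiable ℂ (charFun a b) := by
  have h1 : charFun a b = fun z => fundamentalSolution ha hb z 1 :=
    funext (charFun_eq ha hb)
  rw [h1]
  have hq : Differentiable ℂ (coefficient ha hb) := by
    unfold coefficient
    fun_prop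
  have hI := differentiable_inverse_one_sub (differentiable_comp_mul hq (volterra ∘L volterra))
    fun z => isUnit_one_sub_solutionOperator (coefficient ha hb z)
  exact (ContinuousMap.evalCLM ℂ (1 : unitInterval)).differentiable.comp
    (hI.clm_apply (differentiable_const _))

include ha hb in
theorem isEigenvalue_iff (z : ℂ) : IsEigenvalue a b z ↔ charFun a b z = 0 := by
  rw [charFun_eq ha hb]
  constructor
  · rintro ⟨u, v, h, h0, h1, x, hx, hux⟩
    have e1 := h.eq_mul_fundamentalSolution ha hb h0 ⟨x, hx⟩
    have e2 := h.eq_mul_fundamentalSolution ha hb h0 1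
    have hv : v 0 ≠ 0 := fun hv => hux (by rw [e1, hv, zero_mul])
    change u 1 = _ at e2
    rw [h1] at e2
    exact (mul_eq_zero.1 e2.symm).resolve_left hv
  · intro h1
    obtain ⟨u, v, h, h0, hv0, hU⟩ := exists_isSolution ha hb z
    refine ⟨u, v, h, h0, (hU 1).trans h1, ?_⟩
    -- A solution vanishing on all of [0,1] would have derivative 0 at the origin, against v(0) = 1.
    by_contra! hcon
    have hmem : (0 : ℝ) ∈ Icc (0 : ℝ) 1 := by simp
    have d1 := h.deriv_fst 0 hmem
    have d2 : HasDerivWithinAt u 0 (Icc 0 1) (0 : ℝ) :=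
      (hasDerivWithinAt_const (0 : ℝ) (Icc 0 1) (0 : ℂ)).congr hcon (hcon 0 hmem)
    have := (uniqueDiffOn_Icc zero_lt_one 0 hmem).eq_deriv _ d1 d2
    rw [hv0] at this
    exact one_ne_zero this

end CharFun


/-! ### Liouville–Green approximation with explicit error. -/

section LiouvilleGreen

variable {P P' s s' q u v Th Sg : ℝ → ℂ}

/-- Variation of constants with respect to the functions `exp (∫ (± P + s))`. -/
noncomputable def lgTransform (P s u v Th Sg : ℝ → ℂ) (x t : ℝ) : ℂ :=
  ((v t - (s t - P t) * u t) * Complex.exp ((Th x - Th t) + (Sg x - Sg t)) +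
    ((s t + P t) * u t - v t) * Complex.exp (-(Th x - Th t) + (Sg x - Sg t))) / (2 * P t)

theorem lgTransform_self {x : ℝ} (hP0 : P x ≠ 0) : lgTransform P s u v Th Sg x x = u x := by
  simp only [lgTransform, sub_self, neg_zero, add_zero, Complex.exp_zero, mul_one]
  field_simp
  ring

theorem lgTransform_zero {x : ℝ} (hu : u 0 = 0) (hv : v 0 = 1) :
    lgTransform P s u v Th Sg x 0 =
      Complex.exp (Sg x - Sg 0) * Complex.sinh (Th x - Th 0) / P 0 := by
  simp only [lgTransform, hu, hv, Complex.exp_add, Complex.sinh]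
  ring

/-- The condition 2Ps + P' = 0 removes the cross term, so exp(±∫P + ∫s) solves w'' = (P² + s² + s')w
exactly. All that survives in the derivative is the residual P² + s² + s' - q times u. -/
theorem hasDerivWithinAt_lgTransform {S : Set ℝ} {t : ℝ} (x : ℝ)
    (hP : HasDerivWithinAt P (P' t) S t) (hs : HasDerivWithinAt s (s' t) S t)
    (hTh : HasDerivWithinAt Th (P t) S t) (hSg : HasDerivWithinAt Sg (s t) S t)
    (hu : HasDerivWithinAt u (v t) S t) (hv : HasDerivWithinAt v (q t * u t) S t)
    (hP0 : P t ≠ 0) (hPs : 2 * P t * s t + P' t = 0) :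
    HasDerivWithinAt (lgTransform P s u v Th Sg x)
      ((P t ^ 2 + s t ^ 2 + s' t - q t) * u t / (2 * P t) *
        (Complex.exp (-(Th x - Th t) + (Sg x - Sg t)) -
          Complex.exp ((Th x - Th t) + (Sg x - Sg t)))) S t := by
  have e1 := ((hTh.const_sub (Th x)).add (hSg.const_sub (Sg x))).cexp
  have e2 := ((hTh.const_sub (Th x)).neg.add (hSg.const_sub (Sg x))).cexp
  have n1 := (hv.sub ((hs.sub hP).mul hu)).mul e1
  have n2 := (((hs.add hP).mul hu).sub hv).mul e2
  have h := (n1.add n2).div (hP.const_mul 2) (mul_ne_zero two_ne_zero hP0)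
  have hP' : P' t = -(2 * P t * s t) := by linear_combination hPs
  refine h.congr_deriv ?_
  simp only [Pi.add_apply, Pi.sub_apply, Pi.neg_apply, Pi.mul_apply, hP']
  field_simp
  ring

/-- As t runs from 0 to x the transform moves from the explicit leading term to u(x), and its
derivative is small with the residual ρ. The mean value inequality then bounds the error by ρ times
a supremum of u, which is estimated in turn by absorption. -/
theorem norm_sub_sinh_le {κ B ρ L : ℝ}
    (hP : ∀ t ∈ Icc (0 : ℝ) 1, HasDerivWithinAt P (P' t) (Icc 0 1) t)
    (hs : ∀ t ∈ Icc (0 : ℝ) 1, HasDerivWithinAt s (s' t) (Icc 0 1) t)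
    (hTh : ∀ t ∈ Icc (0 : ℝ) 1, HasDerivWithinAt Th (P t) (Icc 0 1) t)
    (hSg : ∀ t ∈ Icc (0 : ℝ) 1, HasDerivWithinAt Sg (s t) (Icc 0 1) t)
    (hu : ∀ t ∈ Icc (0 : ℝ) 1, HasDerivWithinAt u (v t) (Icc 0 1) t)
    (hv : ∀ t ∈ Icc (0 : ℝ) 1, HasDerivWithinAt v (q t * u t) (Icc 0 1) t)
    (hPs : ∀ t ∈ Icc (0 : ℝ) 1, 2 * P t * s t + P' t = 0)
    (hu0 : u 0 = 0) (hv0 : v 0 = 1) (hL : 0 < L) (hPL : ∀ t ∈ Icc (0 : ℝ) 1, L ≤ ‖2 * P t‖)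
    (hρ : ∀ t ∈ Icc (0 : ℝ) 1, ‖P t ^ 2 + s t ^ 2 + s' t - q t‖ ≤ ρ)
    (hE : ∀ t x : ℝ, 0 ≤ t → t ≤ x → x ≤ 1 →
      |(Th x - Th t).re| + |(Sg x - Sg t).re| ≤ κ * (x - t) + B)
    (hsmall : 2 * ρ * Real.exp B / L ≤ 1 / 2) :
    ‖u 1 - Complex.exp (Sg 1 - Sg 0) * Complex.sinh (Th 1 - Th 0) / P 0‖ ≤
      8 * ρ * Real.exp B ^ 2 / L ^ 2 * Real.exp κ := by
  have hmem : (0 : ℝ) ∈ Icc (0 : ℝ) 1 := by simp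
  have hρ0 : 0 ≤ ρ := (norm_nonneg _).trans (hρ 0 hmem)
  have hP0 : ∀ t ∈ Icc (0 : ℝ) 1, P t ≠ 0 := fun t ht h0 => by
    have := hPL t ht
    rw [h0, mul_zero, norm_zero] at this
    linarith
  have hexp : ∀ t x : ℝ, 0 ≤ t → t ≤ x → x ≤ 1 →
      ‖Complex.exp ((Th x - Th t) + (Sg x - Sg t))‖ ≤ Real.exp (κ * (x - t) + B) ∧
      ‖Complex.exp (-(Th x - Th t) + (Sg x - Sg t))‖ ≤ Real.exp (κ * (x - t) + B) := by
    intro t x h0 h1 h2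
    have h := hE t x h0 h1 h2
    simp only [Complex.norm_exp, Complex.add_re, Complex.neg_re, Real.exp_le_exp]
    have h3 := abs_le.1 (le_refl |(Th x - Th t).re|)
    have h4 := le_abs_self (Sg x - Sg t).re
    constructor <;> linarith
  -- The expected growth exp(κx) is divided out before taking the maximum `K`.
  obtain ⟨x₀, hx₀, hmax⟩ := isCompact_Icc.exists_isMaxOn (⟨0, hmem⟩ : (Icc (0 : ℝ) 1).Nonempty)
    (f := fun x => ‖u x‖ * Real.exp (-(κ * x)))
    (ContinuousOn.mul (fun x hx => (hu x hx).continuousWithinAt.norm) (by fun_prop))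
  set K := ‖u x₀‖ * Real.exp (-(κ * x₀)) with hK
  have hK0 : 0 ≤ K := by positivity
  have huK : ∀ t ∈ Icc (0 : ℝ) 1, ‖u t‖ ≤ K * Real.exp (κ * t) := by
    intro t ht
    have h : ‖u t‖ * Real.exp (-(κ * t)) ≤ K := hmax ht
    rw [Real.exp_neg, ← div_eq_mul_inv, div_le_iff₀ (Real.exp_pos _)] at h
    exact h
  have hdiff : ∀ x ∈ Icc (0 : ℝ) 1,
      ‖u x - Complex.exp (Sg x - Sg 0) * Complex.sinh (Th x - Th 0) / P 0‖ ≤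
        2 * ρ * Real.exp B / L * K * Real.exp (κ * x) := by
    intro x hx
    rw [← lgTransform_self (s := s) (u := u) (v := v) (Th := Th) (Sg := Sg) (hP0 x hx),
      ← lgTransform_zero (s := s) (P := P) hu0 hv0]
    have hsub : Icc (0 : ℝ) x ⊆ Icc 0 1 := Icc_subset_Icc_right hx.2
    have hmv := (convex_Icc (0 : ℝ) x).norm_image_sub_le_of_norm_hasDerivWithin_le
      (C := 2 * ρ * Real.exp B / L * K * Real.exp (κ * x))
      (fun t ht => (hasDerivWithinAt_lgTransform (s' := s') x (hP t (hsub ht)) (hs t (hsub ht))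
        (hTh t (hsub ht)) (hSg t (hsub ht)) (hu t (hsub ht)) (hv t (hsub ht)) (hP0 t (hsub ht))
        (hPs t (hsub ht))).mono hsub) (fun t ht => ?_) (left_mem_Icc.2 hx.1) (right_mem_Icc.2 hx.1)
    · refine hmv.trans ?_
      rw [sub_zero, Real.norm_of_nonneg hx.1]
      exact mul_le_of_le_one_right (by positivity) hx.2
    · obtain ⟨h1, h2⟩ := hexp t x ht.1 ht.2 hx.2
      rw [norm_mul, norm_div, norm_mul]
      have h3 := (norm_sub_le (Complex.exp (-(Th x - Th t) + (Sg x - Sg t)))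
        (Complex.exp ((Th x - Th t) + (Sg x - Sg t)))).trans (add_le_add h2 h1)
      calc _ ≤ ρ * (K * Real.exp (κ * t)) / L *
            (Real.exp (κ * (x - t) + B) + Real.exp (κ * (x - t) + B)) := by
            have h4 := hρ t (hsub ht)
            have h5 := huK t (hsub ht)
            have h6 := hPL t (hsub ht)
            gcongr
        _ = 2 * ρ * Real.exp B / L * K * (Real.exp (κ * t) * Real.exp (κ * (x - t))) := by
            rw [Real.exp_add]; ring
        _ = _ := by
            rw [← Real.exp_add]; congr 2; ring
  have hmain : ∀ x ∈ Icc (0 : ℝ) 1,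
      ‖Complex.exp (Sg x - Sg 0) * Complex.sinh (Th x - Th 0) / P 0‖ ≤
        2 * Real.exp B / L * Real.exp (κ * x) := by
    intro x hx
    obtain ⟨h1, h2⟩ := hexp 0 x le_rfl hx.1 hx.2
    rw [sub_zero, Real.exp_add] at h1 h2
    have h0 : Complex.exp (Sg x - Sg 0) * Complex.sinh (Th x - Th 0) / P 0 =
        (Complex.exp ((Th x - Th 0) + (Sg x - Sg 0)) -
          Complex.exp (-(Th x - Th 0) + (Sg x - Sg 0))) / (2 * P 0) := by
      simp only [Complex.exp_add, Complex.sinh]; ring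
    rw [h0, norm_div]
    calc _ ≤ (Real.exp (κ * x) * Real.exp B + Real.exp (κ * x) * Real.exp B) / L := by
          have h6 := hPL 0 hmem
          have h7 := (norm_sub_le (Complex.exp ((Th x - Th 0) + (Sg x - Sg 0)))
            (Complex.exp (-(Th x - Th 0) + (Sg x - Sg 0)))).trans (add_le_add h1 h2)
          gcongr
      _ = _ := by ring
  -- At the maximum point `hsmall` makes the error at most K/2, which is absorbed on the left.
  have hKle : K ≤ 4 * Real.exp B / L := by
    have h1 := norm_le_norm_sub_add (u x₀)
      (Complex.exp (Sg x₀ - Sg 0) * Complex.sinh (Th x₀ - Th 0) / P 0)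
    have h2 := hdiff x₀ hx₀
    have h3 := hmain x₀ hx₀
    have h4 : ‖u x₀‖ = K * Real.exp (κ * x₀) := by
      rw [hK, mul_assoc, ← Real.exp_add]; simp
    have h5 : K * Real.exp (κ * x₀) ≤
        (2 * ρ * Real.exp B / L * K + 2 * Real.exp B / L) * Real.exp (κ * x₀) := by
      rw [← h4]; linarith
    have h6 := le_of_mul_le_mul_right h5 (Real.exp_pos _)
    have h7 : 2 * ρ * Real.exp B / L * K ≤ 1 / 2 * K := by gcongr
    have h8 : 4 * Real.exp B / L = 2 * (2 * Real.exp B / L) := by ring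
    rw [h8]
    linarith
  refine (hdiff 1 (by simp)).trans ?_
  rw [mul_one]
  calc _ ≤ 2 * ρ * Real.exp B / L * (4 * Real.exp B / L) * Real.exp κ := by gcongr
    _ = _ := by ring

end LiouvilleGreen

/-! ### Asymptotics of the characteristic function for large spectral parameter. -/

section Asymptotics

theorem exists_primitive_of_continuousOn {f : ℝ → ℂ} (hf : ContinuousOn f (Icc 0 1)) :
    ∃ F : ℝ → ℂ, ∀ x ∈ Icc (0 : ℝ) 1, HasDerivWithinAt F (f x) (Icc 0 1) x := by
  let g : C(unitInterval, ℂ) := ⟨fun x => f x, hf.domRestrict⟩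
  refine ⟨primitive g, fun x hx => ?_⟩
  have h := (hasDerivAt_primitive g x).hasDerivWithinAt (s := Icc 0 1)
  rwa [IccExtend_of_mem _ _ hx] at h

theorem exists_primitive_mean {f : ℝ → ℝ} (hf : ContinuousOn f (Icc 0 1)) :
    ∃ F : ℝ → ℂ, (∀ x ∈ Icc (0 : ℝ) 1, HasDerivWithinAt F (f x) (Icc 0 1) x) ∧
      F 1 - F 0 = mean f := by
  obtain ⟨F, hF⟩ := exists_primitive_of_continuousOn (Complex.continuous_ofReal.comp_continuousOn hf)
  refine ⟨F, hF, ?_⟩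
  refine (sub_eq_primitive hF (restrictIcc f hf) (fun x => rfl) 1).trans ?_
  rw [mean, primitive, ← intervalIntegral.integral_ofReal]
  apply intervalIntegral.integral_congr
  intro x hx
  rw [show ((1 : unitInterval) : ℝ) = 1 from rfl, uIcc_of_le zero_le_one] at hx
  exact IccExtend_of_mem _ _ hx

/-- The first and second derivatives on `[0,1]` of a function, with a common bound. -/
theorem exists_bounded_derivs {f : ℝ → ℝ} (hf : ContDiffOn ℝ 2 f (Icc 0 1)) :
    ∃ (f₁ f₂ : ℝ → ℝ) (M : ℝ),
      (∀ x ∈ Icc (0 : ℝ) 1, HasDerivWithinAt f (f₁ x) (Icc 0 1) x) ∧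
      (∀ x ∈ Icc (0 : ℝ) 1, HasDerivWithinAt f₁ (f₂ x) (Icc 0 1) x) ∧
      ∀ x ∈ Icc (0 : ℝ) 1, |f x| ≤ M ∧ |f₁ x| ≤ M ∧ |f₂ x| ≤ M := by
  have hU : UniqueDiffOn ℝ (Icc (0 : ℝ) 1) := uniqueDiffOn_Icc zero_lt_one
  have h1 : ContDiffOn ℝ 1 (derivWithin f (Icc 0 1)) (Icc 0 1) :=
    hf.derivWithin hU (by norm_num)
  have h2 : ContinuousOn (derivWithin (derivWithin f (Icc 0 1)) (Icc 0 1)) (Icc 0 1) :=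
    h1.continuousOn_derivWithin hU le_rfl
  obtain ⟨M₀, hM₀⟩ := isCompact_Icc.exists_bound_of_continuousOn hf.continuousOn
  obtain ⟨M₁, hM₁⟩ := isCompact_Icc.exists_bound_of_continuousOn h1.continuousOn
  obtain ⟨M₂, hM₂⟩ := isCompact_Icc.exists_bound_of_continuousOn h2
  refine ⟨_, _, max M₀ (max M₁ M₂),
    fun x hx => (hf.differentiableOn (by norm_num) x hx).hasDerivWithinAt,
    fun x hx => (h1.differentiableOn (by norm_num) x hx).hasDerivWithinAt, fun x hx => ?_⟩
  exact ⟨(hM₀ x hx).trans (le_max_left _ _),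
    (hM₁ x hx).trans ((le_max_left _ _).trans (le_max_right _ _)),
    (hM₂ x hx).trans ((le_max_right _ _).trans (le_max_right _ _))⟩

/-- The phase `z + ⟨a⟩ - ⟨a² + b⟩ / (2 z)` of the characteristic function. -/
noncomputable def phase (a b : ℝ → ℝ) (z : ℂ) : ℂ :=
  z + mean a - mean (fun x => a x ^ 2 + b x) / (2 * z)

theorem charFun_eq_of_isSolution {a b : ℝ → ℝ} (ha : ContinuousOn a (Icc 0 1))
    (hb : ContinuousOn b (Icc 0 1)) (z : ℂ) :
    ∃ u v : ℝ → ℂ, IsSolution a b z u v ∧ u 0 = 0 ∧ v 0 = 1 ∧ u 1 = charFun a b z := by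
  obtain ⟨u, v, h, h0, h1, hU⟩ := exists_isSolution ha hb z
  exact ⟨u, v, h, h0, h1, by rw [charFun_eq ha hb]; exact hU 1⟩

theorem norm_sub_div_two_mul_le {M : ℝ} (hM : 1 ≤ M) {z : ℂ} (hz : 4 * M ≤ ‖z‖) {x y : ℝ}
    (hx : |x| ≤ M) (hy : |y| ≤ M) : ‖(x : ℂ) - y / (2 * z)‖ ≤ 2 * M := by
  have hz0 : 0 < ‖z‖ := by linarith
  refine (norm_sub_le _ _).trans ?_
  rw [norm_div, norm_mul, Complex.norm_real, Complex.norm_real, Real.norm_eq_abs, Real.norm_eq_abs,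
    Complex.norm_ofNat]
  have : |y| / (2 * ‖z‖) ≤ M := by
    rw [div_le_iff₀ (by positivity)]
    nlinarith
  linarith

/-- The Liouville–Green estimate applied to P = z + a - (a² + b)/(2z) and s = -P'/(2P). The leading
term is exp(σ) sinh(phase)/P(0) with σ = ∫s = O(1/z); the factor m = P(0) exp(-σ)/z normalises it
without moving any large zero. -/
theorem charFun_asymptotics {a b : ℝ → ℝ} (ha : ContDiffOn ℝ 2 a (Icc 0 1))
    (hb : ContDiffOn ℝ 2 b (Icc 0 1)) :
    ∃ C R : ℝ, 0 < C ∧ 1 ≤ R ∧ ∀ z : ℂ, R ≤ ‖z‖ → ∃ m : ℂ, ‖m - 1‖ ≤ C / ‖z‖ ∧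
      ‖z * charFun a b z * m - Complex.sinh (phase a b z)‖ ≤
        C * Real.exp |z.re| / ‖z‖ ^ 2 := by
  set g : ℝ → ℝ := fun x => a x ^ 2 + b x with hgdef
  have hg : ContDiffOn ℝ 2 g (Icc 0 1) := (ha.pow 2).add hb
  obtain ⟨a₁, a₂, Ma, hda, hda₁, hMa⟩ := exists_bounded_derivs ha
  obtain ⟨g₁, g₂, Mg, hdg, hdg₁, hMg⟩ := exists_bounded_derivs hg
  obtain ⟨A, hA, hAm⟩ := exists_primitive_mean ha.continuousOn
  obtain ⟨G, hG, hGm⟩ := exists_primitive_mean hg.continuousOn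
  obtain ⟨M, hM1, hMa', hMg'⟩ : ∃ M : ℝ, 1 ≤ M ∧ Ma ≤ M ∧ Mg ≤ M :=
    ⟨max 1 (max Ma Mg), le_max_left _ _, (le_max_left _ _).trans (le_max_right _ _),
      (le_max_right _ _).trans (le_max_right _ _)⟩
  set B : ℝ := 2 * M + 1 with hB
  have hB1 : 1 ≤ Real.exp B := Real.one_le_exp (by linarith)
  -- 28 = 2·2·7 secures the smallness condition of `norm_sub_sinh_le` with ρ = 7M²/|z| and L = |z|;
  -- 168 = 8·7·3, the 3 coming from |zm| ≤ 3|z|.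
  have key : ∀ z : ℂ, 28 * M ^ 2 * Real.exp B ≤ ‖z‖ → ∃ m : ℂ, ‖m - 1‖ ≤ 8 * M / ‖z‖ ∧
      ‖z * charFun a b z * m - Complex.sinh (phase a b z)‖ ≤
        168 * M ^ 2 * Real.exp B ^ 2 * Real.exp |z.re| / ‖z‖ ^ 2 := by
    intro z hzR
    have hz4 : 4 * M ≤ ‖z‖ := by nlinarith [mul_le_mul hM1 hB1 zero_le_one (by linarith)]
    have hz0 : 0 < ‖z‖ := by linarith
    have hzne : z ≠ 0 := norm_pos_iff.1 hz0
    have hba : ∀ x ∈ Icc (0 : ℝ) 1, |a x| ≤ M ∧ |a₁ x| ≤ M ∧ |a₂ x| ≤ M := fun x hx =>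
      ⟨(hMa x hx).1.trans hMa', (hMa x hx).2.1.trans hMa', (hMa x hx).2.2.trans hMa'⟩
    have hbg : ∀ x ∈ Icc (0 : ℝ) 1, |g x| ≤ M ∧ |g₁ x| ≤ M ∧ |g₂ x| ≤ M := fun x hx =>
      ⟨(hMg x hx).1.trans hMg', (hMg x hx).2.1.trans hMg', (hMg x hx).2.2.trans hMg'⟩
    set p : ℝ → ℂ := fun x => (a x : ℂ) - g x / (2 * z) with hp
    set P : ℝ → ℂ := fun x => z + p x with hP
    set P₁ : ℝ → ℂ := fun x => (a₁ x : ℂ) - g₁ x / (2 * z) with hP₁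
    set P₂ : ℝ → ℂ := fun x => (a₂ x : ℂ) - g₂ x / (2 * z) with hP₂
    have hpb : ∀ x ∈ Icc (0 : ℝ) 1, ‖p x‖ ≤ 2 * M := fun x hx =>
      norm_sub_div_two_mul_le hM1 hz4 (hba x hx).1 (hbg x hx).1
    have hP₁b : ∀ x ∈ Icc (0 : ℝ) 1, ‖P₁ x‖ ≤ 2 * M := fun x hx =>
      norm_sub_div_two_mul_le hM1 hz4 (hba x hx).2.1 (hbg x hx).2.1
    have hP₂b : ∀ x ∈ Icc (0 : ℝ) 1, ‖P₂ x‖ ≤ 2 * M := fun x hx =>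
      norm_sub_div_two_mul_le hM1 hz4 (hba x hx).2.2 (hbg x hx).2.2
    have hPlow : ∀ x ∈ Icc (0 : ℝ) 1, ‖z‖ ≤ ‖2 * P x‖ := by
      intro x hx
      have h1 : ‖z‖ - ‖p x‖ ≤ ‖P x‖ := by
        have := norm_sub_le (P x) (p x)
        rw [hP, add_sub_cancel_right] at this
        linarith
      have h2 := hpb x hx
      rw [norm_mul, Complex.norm_ofNat]
      linarith
    have hP0 : ∀ x ∈ Icc (0 : ℝ) 1, P x ≠ 0 := fun x hx h0 => by
      have := hPlow x hx
      rw [h0, mul_zero, norm_zero] at this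
      linarith
    set s : ℝ → ℂ := fun x => -(P₁ x / (2 * P x)) with hs
    set s₁ : ℝ → ℂ := fun x => -((P₂ x * (2 * P x) - P₁ x * (2 * P₁ x)) / (2 * P x) ^ 2) with hs₁
    have hdP : ∀ x ∈ Icc (0 : ℝ) 1, HasDerivWithinAt P (P₁ x) (Icc 0 1) x := fun x hx =>
      ((hda x hx).ofReal_comp.sub ((hdg x hx).ofReal_comp.div_const (2 * z))).const_add z
    have hdP₁ : ∀ x ∈ Icc (0 : ℝ) 1, HasDerivWithinAt P₁ (P₂ x) (Icc 0 1) x := fun x hx =>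
      (hda₁ x hx).ofReal_comp.sub ((hdg₁ x hx).ofReal_comp.div_const (2 * z))
    have hds : ∀ x ∈ Icc (0 : ℝ) 1, HasDerivWithinAt s (s₁ x) (Icc 0 1) x := fun x hx =>
      ((hdP₁ x hx).div ((hdP x hx).const_mul 2) (mul_ne_zero two_ne_zero (hP0 x hx))).neg
    have hsb : ∀ x ∈ Icc (0 : ℝ) 1, ‖s x‖ ≤ 2 * M / ‖z‖ := by
      intro x hx
      have h1 := hPlow x hx
      have h2 := hP₁b x hx
      rw [hs, norm_neg, norm_div]
      gcongr
    have hs₁b : ∀ x ∈ Icc (0 : ℝ) 1, ‖s₁ x‖ ≤ 4 * M / ‖z‖ := by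
      intro x hx
      have h1 := hPlow x hx
      have h2 := hP₁b x hx
      have h3 := hP₂b x hx
      have h4 : s₁ x = -(P₂ x / (2 * P x)) + 2 * (P₁ x / (2 * P x)) ^ 2 := by
        have := hP0 x hx
        simp only [hs₁]
        field_simp
        ring
      have h5 : ‖P₂ x / (2 * P x)‖ ≤ 2 * M / ‖z‖ := by
        rw [norm_div]; gcongr
      have h6 : ‖P₁ x / (2 * P x)‖ ≤ 2 * M / ‖z‖ := by
        rw [norm_div]; gcongr
      rw [h4]
      refine (norm_add_le _ _).trans ?_
      rw [norm_neg, norm_mul, norm_pow, Complex.norm_ofNat]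
      have h7 : ‖P₁ x / (2 * P x)‖ ^ 2 ≤ (2 * M / ‖z‖) * (1 / 2) := by
        rw [sq]
        refine mul_le_mul h6 (h6.trans ?_) (norm_nonneg _) (by positivity)
        rw [div_le_iff₀ hz0]; linarith
      have h8 : 4 * M / ‖z‖ = 2 * (2 * M / ‖z‖) := by ring
      rw [h8]
      linarith
    have hr : ∀ x ∈ Icc (0 : ℝ) 1,
        ‖P x ^ 2 + s x ^ 2 + s₁ x - (z ^ 2 + 2 * z * (a x : ℂ) - (b x : ℂ))‖ ≤
          7 * M ^ 2 / ‖z‖ := by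
      intro x hx
      -- The choice g = a² + b cancels the terms of order z², z and 1.
      have h1 : P x ^ 2 + s x ^ 2 + s₁ x - (z ^ 2 + 2 * z * (a x : ℂ) - (b x : ℂ)) =
          (-((a x : ℂ) * g x / z) + (g x : ℂ) ^ 2 / (4 * z ^ 2)) + s x ^ 2 + s₁ x := by
        simp only [hP, hp, hgdef]
        push_cast
        field_simp
        ring
      have ha0 := (hba x hx).1
      have hg0 := (hbg x hx).1
      have h2 : ‖(a x : ℂ) * g x / z‖ ≤ M * M / ‖z‖ := by
        rw [norm_div, norm_mul, Complex.norm_real, Complex.norm_real, Real.norm_eq_abs,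
          Real.norm_eq_abs]
        gcongr
      have h3 : ‖(g x : ℂ) ^ 2 / (4 * z ^ 2)‖ ≤ M * M / ‖z‖ := by
        rw [norm_div, norm_mul, norm_pow, norm_pow, Complex.norm_real, Real.norm_eq_abs,
          Complex.norm_ofNat, sq]
        apply div_le_div₀ (by positivity) (by gcongr) hz0
        nlinarith
      have h4 : ‖s x ^ 2‖ ≤ (2 * M / ‖z‖) * (1 / 2) := by
        have h6 := hsb x hx
        rw [norm_pow, sq]
        refine mul_le_mul h6 (h6.trans ?_) (norm_nonneg _) (by positivity)
        rw [div_le_iff₀ hz0]; linarith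
      have h5 := hs₁b x hx
      rw [h1]
      refine (norm_add₃_le).trans ?_
      have h6 := (norm_add_le (-((a x : ℂ) * g x / z)) ((g x : ℂ) ^ 2 / (4 * z ^ 2)))
      rw [norm_neg] at h6
      have h7 : M * M / ‖z‖ + M * M / ‖z‖ + (2 * M / ‖z‖) * (1 / 2) + 4 * M / ‖z‖ ≤
          7 * M ^ 2 / ‖z‖ := by
        have : M * M / ‖z‖ + M * M / ‖z‖ + (2 * M / ‖z‖) * (1 / 2) + 4 * M / ‖z‖ =
          (2 * M ^ 2 + 5 * M) / ‖z‖ := by ring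
        rw [this]
        gcongr
        nlinarith
      linarith
    have hcs : ContinuousOn s (Icc 0 1) := fun x hx => (hds x hx).continuousWithinAt
    obtain ⟨Sg, hSg⟩ := exists_primitive_of_continuousOn hcs
    set Th : ℝ → ℂ := fun x => z * x + (A x - G x / (2 * z)) with hTh
    have hdTh : ∀ x ∈ Icc (0 : ℝ) 1, HasDerivWithinAt Th (P x) (Icc 0 1) x := by
      intro x hx
      have h1 := ((Complex.ofRealCLM.hasDerivAt (x := x)).const_mul z).hasDerivWithinAt
        (s := Icc 0 1)
      simp only [Complex.ofRealCLM_apply, Complex.ofReal_one, mul_one] at h1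
      exact h1.add ((hA x hx).sub ((hG x hx).div_const (2 * z)))
    have hlip : ∀ t x : ℝ, 0 ≤ t → t ≤ x → x ≤ 1 →
        ‖Th x - Th t - z * ((x : ℂ) - t)‖ ≤ 2 * M ∧ ‖Sg x - Sg t‖ ≤ 2 * M / ‖z‖ := by
      intro t x h0 h1 h2
      have ht : t ∈ Icc (0 : ℝ) 1 := ⟨h0, h1.trans h2⟩
      have hx : x ∈ Icc (0 : ℝ) 1 := ⟨h0.trans h1, h2⟩
      have hxt : ‖x - t‖ ≤ 1 := by rw [Real.norm_of_nonneg] <;> linarith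
      constructor
      · have e1 := (convex_Icc (0 : ℝ) 1).norm_image_sub_le_of_norm_hasDerivWithin_le
          (fun y hy => (hA y hy).sub ((hG y hy).div_const (2 * z))) hpb ht hx
        refine le_trans (le_of_eq ?_) (e1.trans (mul_le_of_le_one_right (by linarith) hxt))
        congr 1
        simp only [hTh, Pi.sub_apply]
        ring
      · exact ((convex_Icc (0 : ℝ) 1).norm_image_sub_le_of_norm_hasDerivWithin_le hSg hsb ht hx).trans
          (mul_le_of_le_one_right (by positivity) hxt)
    have h2Mz : 2 * M / ‖z‖ ≤ 1 / 2 := by rw [div_le_iff₀ hz0]; linarith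
    have hE : ∀ t x : ℝ, 0 ≤ t → t ≤ x → x ≤ 1 →
        |(Th x - Th t).re| + |(Sg x - Sg t).re| ≤ |z.re| * (x - t) + B := by
      intro t x h0 h1 h2
      obtain ⟨e1, e2⟩ := hlip t x h0 h1 h2
      have e3 := (Complex.abs_re_le_norm _).trans e1
      have e4 := (Complex.abs_re_le_norm _).trans e2
      have e5 : (Th x - Th t).re = (Th x - Th t - z * ((x : ℂ) - t)).re + z.re * (x - t) := by
        simp
      have e6 := abs_add_le (Th x - Th t - z * ((x : ℂ) - t)).re (z.re * (x - t))
      rw [← e5, abs_mul, abs_of_nonneg (sub_nonneg.2 h1)] at e6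
      rw [hB]
      linarith
    obtain ⟨u, v, hsol, hu0, hv0, hu1⟩ := charFun_eq_of_isSolution ha.continuousOn hb.continuousOn z
    have hmem : (0 : ℝ) ∈ Icc (0 : ℝ) 1 := by simp
    have hest := norm_sub_sinh_le (κ := |z.re|) (B := B) (ρ := 7 * M ^ 2 / ‖z‖) (L := ‖z‖)
      hdP hds hdTh hSg hsol.deriv_fst hsol.deriv_snd (fun x hx => by
        have := hP0 x hx
        simp only [hs]
        field_simp
        ring) hu0 hv0 hz0 hPlow hr hE (by
        rw [div_le_iff₀ hz0, mul_div_assoc', div_mul_eq_mul_div, div_le_iff₀ hz0]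
        nlinarith)
    set σ := Sg 1 - Sg 0 with hσ
    have hσb : ‖σ‖ ≤ 2 * M / ‖z‖ := (hlip 0 1 le_rfl zero_le_one le_rfl).2
    have hThp : Th 1 - Th 0 = phase a b z := by
      simp only [hTh, phase, ← hgdef, ← hAm, ← hGm]
      push_cast
      ring
    have hexpσ : ‖Complex.exp (-σ) - 1‖ ≤ 2 * (2 * M / ‖z‖) := by
      have h1 := Complex.norm_exp_sub_one_le (x := -σ) (by rw [norm_neg]; linarith)
      rw [norm_neg] at h1
      linarith
    have hm : ‖P 0 / z * Complex.exp (-σ) - 1‖ ≤ 8 * M / ‖z‖ := by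
      have h1 : P 0 / z * Complex.exp (-σ) - 1 =
          p 0 / z + (Complex.exp (-σ) - 1) + p 0 / z * (Complex.exp (-σ) - 1) := by
        simp only [hP]
        field_simp
        ring
      have h2 : ‖p 0 / z‖ ≤ 2 * M / ‖z‖ := by
        rw [norm_div]
        have := hpb 0 hmem
        gcongr
      rw [h1]
      refine (norm_add₃_le).trans ?_
      have h3 : ‖p 0 / z * (Complex.exp (-σ) - 1)‖ ≤ 1 / 2 * (2 * (2 * M / ‖z‖)) := by
        rw [norm_mul]
        exact mul_le_mul (h2.trans h2Mz) hexpσ (norm_nonneg _) (by norm_num)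
      have h4 : 8 * M / ‖z‖ = 4 * (2 * M / ‖z‖) := by ring
      rw [h4]
      linarith
    refine ⟨P 0 / z * Complex.exp (-σ), hm, ?_⟩
    rw [hu1, hThp] at hest
    set m := P 0 / z * Complex.exp (-σ) with hmdef
    have hmn : ‖z * m‖ ≤ 3 * ‖z‖ := by
      have h1 := norm_le_norm_sub_add m 1
      rw [norm_one] at h1
      rw [norm_mul, mul_comm]
      have h2 : 8 * M / ‖z‖ ≤ 2 := by rw [div_le_iff₀ hz0]; linarith
      have h3 : ‖m‖ ≤ 3 := by linarith
      gcongr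
    have hfac : z * charFun a b z * m - Complex.sinh (phase a b z) =
        (charFun a b z - Complex.exp σ * Complex.sinh (phase a b z) / P 0) * (z * m) := by
      have h1 := hP0 0 hmem
      have h2 : Complex.exp σ * Complex.exp (-σ) = 1 := by
        rw [← Complex.exp_add]; simp
      rw [hmdef]
      field_simp
      linear_combination Complex.sinh (phase a b z) * h2
    rw [hfac, norm_mul]
    calc _ ≤ 8 * (7 * M ^ 2 / ‖z‖) * Real.exp B ^ 2 / ‖z‖ ^ 2 * Real.exp |z.re| * (3 * ‖z‖) := by
          gcongr
      _ = _ := by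
          field_simp
          ring
  refine ⟨max (8 * M) (168 * M ^ 2 * Real.exp B ^ 2), max 1 (28 * M ^ 2 * Real.exp B),
    lt_max_of_lt_left (by linarith), le_max_left _ _, fun z hz => ?_⟩
  obtain ⟨m, h1, h2⟩ := key z ((le_max_right _ _).trans hz)
  have hz0 : 0 < ‖z‖ := zero_lt_one.trans_le ((le_max_left _ _).trans hz)
  refine ⟨m, ?_, ?_⟩
  · refine h1.trans ?_
    gcongr
    exact le_max_left _ _
  · refine h2.trans ?_
    gcongr
    exact le_max_right _ _

end Asymptotics


/-! ### Location and exact count of the eigenvalues. -/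

section Spectrum

variable {a b : ℝ → ℝ}

theorem norm_phase_sub_le (a b : ℝ → ℝ) {z : ℂ} (hz : 1 ≤ ‖z‖) :
    ‖phase a b z - (z + mean a)‖ ≤ |mean (fun x => a x ^ 2 + b x)| / ‖z‖ := by
  have hz0 : 0 < ‖z‖ := by linarith
  have h1 : phase a b z - (z + mean a) = -((mean (fun x => a x ^ 2 + b x) : ℂ) / (2 * z)) := by
    rw [phase]; ring
  rw [h1, norm_neg, norm_div, norm_mul, Complex.norm_real, Real.norm_eq_abs, Complex.norm_ofNat]
  gcongr
  linarith

/-- The zeros of the characteristic function lie near the points where the phase is in `π i ℤ`. -/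
theorem exists_int_norm_phase_sub_le (ha : ContDiffOn ℝ 2 a (Icc 0 1))
    (hb : ContDiffOn ℝ 2 b (Icc 0 1)) :
    ∃ C R : ℝ, 0 < C ∧ 1 ≤ R ∧ ∀ z : ℂ, R ≤ ‖z‖ → charFun a b z = 0 →
      ∃ k : ℤ, ‖phase a b z - k * Real.pi * Complex.I‖ ≤ C / ‖z‖ ^ 2 := by
  obtain ⟨C, R, hC, hR, h⟩ := charFun_asymptotics ha hb
  set D := |mean a| + |mean (fun x => a x ^ 2 + b x)| with hD
  set K := 6 * C * Real.exp D with hK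
  have hK0 : 0 < K := by positivity
  refine ⟨K, max R (K + 1), hK0, hR.trans (le_max_left _ _), fun z hz h0 => ?_⟩
  have hzR := (le_max_left _ _).trans hz
  have hz1 : 1 ≤ ‖z‖ := hR.trans hzR
  have hz0 : 0 < ‖z‖ := by linarith
  obtain ⟨m, -, hm⟩ := h z hzR
  rw [h0, mul_zero, zero_mul, zero_sub, norm_neg] at hm
  -- The error carries exp|Re z| and the lower bound for sinh carries exp|Re phase|; they must agree
  -- up to a constant to cancel.
  have hre : |z.re| ≤ D + |(phase a b z).re| := by
    have h1 := (Complex.abs_re_le_norm _).trans (norm_phase_sub_le a b hz1)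
    have h2 : |mean (fun x => a x ^ 2 + b x)| / ‖z‖ ≤ |mean (fun x => a x ^ 2 + b x)| :=
      div_le_self (abs_nonneg _) hz1
    have h3 : z.re = (phase a b z).re - mean a - (phase a b z - (z + mean a)).re := by
      simp
    have h4 := abs_sub ((phase a b z).re - mean a) (phase a b z - (z + mean a)).re
    have h5 := abs_sub (phase a b z).re (mean a)
    rw [← h3] at h4
    linarith
  obtain ⟨k, hk⟩ := exists_int_min_mul_exp_le_norm_sinh (phase a b z)
  refine ⟨k, ?_⟩
  have h1 : min ‖phase a b z - k * Real.pi * Complex.I‖ 1 * Real.exp |(phase a b z).re| ≤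
      K / ‖z‖ ^ 2 * Real.exp |(phase a b z).re| := by
    calc _ ≤ 6 * (C * Real.exp (D + |(phase a b z).re|) / ‖z‖ ^ 2) := by
          refine hk.trans ?_
          refine mul_le_mul_of_nonneg_left (hm.trans ?_) (by norm_num)
          gcongr
      _ = _ := by rw [Real.exp_add, hK]; ring
  have h2 := le_of_mul_le_mul_right h1 (Real.exp_pos _)
  rcases min_le_iff.1 h2 with h3 | h3
  · exact h3
  -- The truncation at 1 is inactive, since |z| ≥ K + 1 gives K/|z|² < 1.
  · exfalso
    rw [le_div_iff₀ (by positivity), one_mul] at h3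
    have := (le_max_right _ _).trans hz
    nlinarith

theorem norm_sinh_add_sub_sinh_le (w : ℂ) {δ : ℂ} (hδ : ‖δ‖ ≤ 1) :
    ‖Complex.sinh (w + δ) - Complex.sinh w‖ ≤ 2 * ‖δ‖ * Real.exp |w.re| := by
  have h1 : Complex.sinh (w + δ) - Complex.sinh w =
      (Complex.exp w * (Complex.exp δ - 1) - Complex.exp (-w) * (Complex.exp (-δ) - 1)) / 2 := by
    simp only [Complex.sinh, neg_add, Complex.exp_add]; ring
  have h2 := Complex.norm_exp_sub_one_le hδ
  have h3 := Complex.norm_exp_sub_one_le (x := -δ) (by rwa [norm_neg])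
  rw [norm_neg] at h3
  have h4 : ‖Complex.exp w‖ ≤ Real.exp |w.re| := by
    rw [Complex.norm_exp]; exact Real.exp_le_exp.2 (le_abs_self _)
  have h5 : ‖Complex.exp (-w)‖ ≤ Real.exp |w.re| := by
    rw [Complex.norm_exp, Complex.neg_re]; exact Real.exp_le_exp.2 (neg_le_abs _)
  rw [h1, norm_div, Complex.norm_ofNat]
  have h6 := norm_sub_le (Complex.exp w * (Complex.exp δ - 1))
    (Complex.exp (-w) * (Complex.exp (-δ) - 1))
  rw [norm_mul, norm_mul] at h6
  have h7 := mul_le_mul h4 h2 (norm_nonneg _) (Real.exp_pos _).le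
  have h8 := mul_le_mul h5 h3 (norm_nonneg _) (Real.exp_pos _).le
  rw [div_le_iff₀ two_pos]
  linarith

theorem norm_sinh_le_exp (w : ℂ) : ‖Complex.sinh w‖ ≤ Real.exp |w.re| := by
  have h4 : ‖Complex.exp w‖ ≤ Real.exp |w.re| := by
    rw [Complex.norm_exp]; exact Real.exp_le_exp.2 (le_abs_self _)
  have h5 : ‖Complex.exp (-w)‖ ≤ Real.exp |w.re| := by
    rw [Complex.norm_exp, Complex.neg_re]; exact Real.exp_le_exp.2 (neg_le_abs _)
  rw [Complex.sinh, norm_div, Complex.norm_ofNat, div_le_iff₀ two_pos]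
  linarith [norm_sub_le (Complex.exp w) (Complex.exp (-w))]

/-- A coarser asymptotic for Rouché's theorem: the 1/z term of the phase and the factor m go into a
relative error O(1/|z|), leaving a comparison function with explicit zeros. -/
theorem norm_mul_charFun_sub_sinh_le (ha : ContDiffOn ℝ 2 a (Icc 0 1))
    (hb : ContDiffOn ℝ 2 b (Icc 0 1)) :
    ∃ K R : ℝ, 0 < K ∧ 1 ≤ R ∧ ∀ z : ℂ, R ≤ ‖z‖ →
      ‖z * charFun a b z - Complex.sinh (z + mean a)‖ ≤
        K / ‖z‖ * Real.exp |(z + mean a).re| := by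
  obtain ⟨C, R, hC, hR, h⟩ := charFun_asymptotics ha hb
  set q := |mean (fun x => a x ^ 2 + b x)| with hq
  have hq0 : 0 ≤ q := abs_nonneg _
  refine ⟨2 * (C * Real.exp |mean a| + 2 * q + C), max R (max (2 * C) q), by positivity,
    hR.trans (le_max_left _ _), fun z hz => ?_⟩
  have hzR := (le_max_left _ _).trans hz
  have hzC := ((le_max_left _ _).trans (le_max_right _ _)).trans hz
  have hzq := ((le_max_right _ _).trans (le_max_right _ _)).trans hz
  have hz1 : 1 ≤ ‖z‖ := hR.trans hzR
  have hz0 : 0 < ‖z‖ := by linarith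
  obtain ⟨m, hm1, hm⟩ := h z hzR
  set w : ℂ := z + mean a with hw
  set E := Real.exp |w.re| with hE
  have hE0 : 0 < E := Real.exp_pos _
  have hδ := norm_phase_sub_le a b hz1
  rw [← hw, ← hq] at hδ
  have hs := norm_sinh_add_sub_sinh_le w (δ := phase a b z - w)
    (hδ.trans (by rw [div_le_iff₀ hz0]; linarith))
  rw [add_sub_cancel] at hs
  have hre : Real.exp |z.re| ≤ Real.exp |mean a| * E := by
    rw [hE, ← Real.exp_add, Real.exp_le_exp]
    have h3 : z.re = w.re - mean a := by simp [hw]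
    rw [h3]
    linarith [abs_sub w.re (mean a)]
  have hmhalf : 1 / 2 ≤ ‖m‖ := by
    have h1 : C / ‖z‖ ≤ 1 / 2 := by rw [div_le_iff₀ hz0]; linarith
    have h2 := norm_sub_norm_le (1 : ℂ) (1 - m)
    rw [sub_sub_cancel, norm_one, norm_sub_rev] at h2
    linarith
  have hid : (z * charFun a b z - Complex.sinh w) * m =
      (z * charFun a b z * m - Complex.sinh (phase a b z)) +
        (Complex.sinh (phase a b z) - Complex.sinh w) + -((m - 1) * Complex.sinh w) := by ring
  have e1 : C * Real.exp |z.re| / ‖z‖ ^ 2 ≤ C * Real.exp |mean a| / ‖z‖ * E := by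
    calc _ ≤ C * (Real.exp |mean a| * E) / ‖z‖ := by
          gcongr
          nlinarith
      _ = _ := by ring
  have e2 : 2 * ‖phase a b z - w‖ * E ≤ 2 * q / ‖z‖ * E := by
    rw [mul_div_assoc]
    gcongr
  have e3 : ‖(m - 1) * Complex.sinh w‖ ≤ C / ‖z‖ * E := by
    rw [norm_mul]
    exact mul_le_mul hm1 (norm_sinh_le_exp w) (norm_nonneg _) (by positivity)
  have h1 := norm_add₃_le (a := z * charFun a b z * m - Complex.sinh (phase a b z))
    (b := Complex.sinh (phase a b z) - Complex.sinh w) (c := -((m - 1) * Complex.sinh w))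
  rw [← hid, norm_neg, norm_mul] at h1
  have h2 : ‖z * charFun a b z - Complex.sinh w‖ * (1 / 2) ≤
      ‖z * charFun a b z - Complex.sinh w‖ * ‖m‖ := by gcongr
  have h3 : 2 * (C * Real.exp |mean a| + 2 * q + C) / ‖z‖ * E =
      2 * (C * Real.exp |mean a| / ‖z‖ * E + 2 * q / ‖z‖ * E + C / ‖z‖ * E) := by ring
  rw [h3]
  linarith

theorem exists_nat_le_pi_mul (x : ℝ) : ∃ N₀ : ℕ, ∀ N : ℕ, N₀ ≤ N → x ≤ Real.pi * (N + 1 / 2) := by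
  obtain ⟨N₀, h⟩ := exists_nat_ge x
  refine ⟨N₀, fun N hN => ?_⟩
  have h1 : (N₀ : ℝ) ≤ N := by exact_mod_cast hN
  have h2 : (0 : ℝ) ≤ N := N.cast_nonneg
  nlinarith [Real.pi_gt_three]

/-- The characteristic function does not vanish identically and has exactly `2 N` zeros in the disc of
centre `-⟨a⟩` and radius `π (N + 1/2)` for large `N`. -/
theorem zeroCount_charFun (ha : ContDiffOn ℝ 2 a (Icc 0 1)) (hb : ContDiffOn ℝ 2 b (Icc 0 1)) :
    (∃ x, charFun a b x ≠ 0) ∧ ∃ N₀ : ℕ, ∀ N : ℕ, N₀ ≤ N →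
      zeroCount (charFun a b) (-(mean a : ℂ)) (Real.pi * (N + 1 / 2)) = 2 * N := by
  obtain ⟨K, R, hK, hR, h⟩ := norm_mul_charFun_sub_sinh_le ha hb
  have hd := differentiable_charFun ha.continuousOn hb.continuousOn
  obtain ⟨N₀, hN₀⟩ := exists_nat_le_pi_mul (|mean a| + R + 12 * K)
  have hlt : ∀ N : ℕ, N₀ ≤ N → ∀ z ∈ sphere (-(mean a : ℂ)) (Real.pi * (N + 1 / 2)),
      ‖z * charFun a b z - Complex.sinh (z + mean a)‖ < ‖Complex.sinh (z + mean a)‖ := by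
    intro N hN z hz
    rw [mem_sphere, dist_eq_norm, sub_neg_eq_add] at hz
    have h1 := exp_le_norm_sinh_of_norm_eq hz
    have h2 := norm_add_le z (mean a : ℂ)
    rw [hz, Complex.norm_real, Real.norm_eq_abs] at h2
    have h3 := hN₀ N hN
    have h4 := h z (by linarith)
    have hz0 : 0 < ‖z‖ := by linarith
    have h5 : K / ‖z‖ ≤ 1 / 12 := by rw [div_le_iff₀ hz0]; linarith
    have h6 : K / ‖z‖ * Real.exp |(z + mean a).re| ≤ 1 / 12 * (6 * ‖Complex.sinh (z + mean a)‖) := by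
      gcongr
    have h7 : 0 < ‖Complex.sinh (z + mean a)‖ := by
      have := Real.exp_pos |(z + mean a).re|
      linarith
    linarith
  have hpos : ∀ N : ℕ, 0 < Real.pi * ((N : ℝ) + 1 / 2) := fun N => by positivity
  have hne : ∃ x, charFun a b x ≠ 0 := by
    obtain ⟨x, hx⟩ : (sphere (-(mean a : ℂ)) (Real.pi * (N₀ + 1 / 2))).Nonempty :=
      NormedSpace.sphere_nonempty.2 (hpos N₀).le
    refine ⟨x, fun h0 => ?_⟩
    have := hlt N₀ le_rfl x hx
    rw [h0, mul_zero, zero_sub, norm_neg] at this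
    exact lt_irrefl _ this
  refine ⟨hne, N₀, fun N hN => ?_⟩
  obtain ⟨x, hx⟩ := hne
  have h1 := zeroCount_eq_of_norm_sub_lt (f := fun z => z * charFun a b z)
    (g := fun z => Complex.sinh (z + mean a)) (by fun_prop) (by fun_prop) (hpos N) (hlt N hN)
  -- The 2N + 1 zeros of the hyperbolic sine, less the one that the factor z contributes at the
  -- origin.
  rw [zeroCount_sinh, zeroCount_id_mul hd hx] at h1
  · omega
  · rw [mem_ball, dist_eq_norm, zero_sub, neg_neg, Complex.norm_real, Real.norm_eq_abs]
    have := hN₀ N hN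
    linarith

/-- The zeros lie near `π i ℤ - ⟨a⟩`. -/
theorem exists_int_norm_sub_le (ha : ContDiffOn ℝ 2 a (Icc 0 1))
    (hb : ContDiffOn ℝ 2 b (Icc 0 1)) :
    ∃ C R : ℝ, 0 < C ∧ 1 ≤ R ∧ ∀ z : ℂ, R ≤ ‖z‖ → charFun a b z = 0 →
      ∃ k : ℤ, ‖phase a b z - k * Real.pi * Complex.I‖ ≤ C / ‖z‖ ^ 2 ∧
        ‖z + mean a - k * Real.pi * Complex.I‖ ≤ 1 / 4 := by
  obtain ⟨C, R, hC, hR, h⟩ := exists_int_norm_phase_sub_le ha hb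
  set q := |mean (fun x => a x ^ 2 + b x)| with hq
  have hq0 : 0 ≤ q := abs_nonneg _
  refine ⟨C, max R (4 * (C + q)), hC, hR.trans (le_max_left _ _), fun z hz h0 => ?_⟩
  have hzR := (le_max_left _ _).trans hz
  have hzC := (le_max_right _ _).trans hz
  have hz1 : 1 ≤ ‖z‖ := hR.trans hzR
  have hz0 : 0 < ‖z‖ := by linarith
  obtain ⟨k, hk⟩ := h z hzR h0
  refine ⟨k, hk, ?_⟩
  have h1 := norm_phase_sub_le a b hz1
  have h2 : z + mean a - k * Real.pi * Complex.I =
      (phase a b z - k * Real.pi * Complex.I) - (phase a b z - (z + mean a)) := by ring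
  have h3 : C / ‖z‖ ^ 2 ≤ C / ‖z‖ := by
    gcongr
    nlinarith
  have h4 : C / ‖z‖ + q / ‖z‖ ≤ 1 / 4 := by
    rw [← add_div, div_le_iff₀ hz0]; linarith
  rw [h2]
  linarith [norm_sub_le (phase a b z - k * Real.pi * Complex.I) (phase a b z - (z + mean a))]

theorem abs_norm_sub_int_mul_pi_le {w : ℂ} {k : ℤ} {r : ℝ}
    (h : ‖w - k * Real.pi * Complex.I‖ ≤ r) :
    |‖w‖ - |k| * Real.pi| ≤ r ∧ |w.im - k * Real.pi| ≤ r ∧ abs (|w.im| - |k| * Real.pi) ≤ r := by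
  have h1 : ‖(k * Real.pi * Complex.I : ℂ)‖ = |k| * Real.pi := by
    simp [abs_of_pos Real.pi_pos]
  have h2 := abs_norm_sub_norm_le w (k * Real.pi * Complex.I)
  have h3 : |w.im - k * Real.pi| ≤ ‖w - k * Real.pi * Complex.I‖ := by
    have := Complex.abs_im_le_norm (w - k * Real.pi * Complex.I)
    simpa using this
  have h4 := abs_abs_sub_abs_le w.im (k * Real.pi)
  rw [abs_mul, abs_of_pos Real.pi_pos, ← Int.cast_abs] at h4
  rw [h1] at h2
  exact ⟨h2.trans h, h3.trans h, (h4.trans h3).trans h⟩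

theorem abs_le_nat_of_mul_pi_lt {k : ℤ} {N : ℕ} (h : (|k| : ℤ) * Real.pi < Real.pi * (N + 1)) :
    |k| ≤ N := by
  rw [mul_comm, mul_lt_mul_iff_right₀ Real.pi_pos] at h
  have h3 : |k| < N + 1 := by exact_mod_cast h
  omega

/-- Zeros are counted in discs but numbered by imaginary part. For a large zero both |z + ⟨a⟩| and
|Im z| are within 1/4 of the same |k|π, so a threshold at π(N + 1/2) does not separate the two
criteria. -/
theorem mem_ball_iff_abs_im_lt (ha : ContDiffOn ℝ 2 a (Icc 0 1))
    (hb : ContDiffOn ℝ 2 b (Icc 0 1)) :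
    ∃ N₀ : ℕ, ∀ N : ℕ, N₀ ≤ N → ∀ z : ℂ, charFun a b z = 0 →
      (z ∈ ball (-(mean a : ℂ)) (Real.pi * (N + 1 / 2)) ↔ |z.im| < Real.pi * (N + 1 / 2)) := by
  obtain ⟨C, R, hC, hR, h⟩ := exists_int_norm_sub_le ha hb
  obtain ⟨N₀, hN₀⟩ := exists_nat_le_pi_mul (|mean a| + R)
  refine ⟨N₀, fun N hN z h0 => ?_⟩
  have hNN := hN₀ N hN
  rw [mem_ball, dist_eq_norm, sub_neg_eq_add]
  have him : (z + mean a).im = z.im := by simp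
  constructor
  · intro h1
    rw [← him]
    exact (Complex.abs_im_le_norm _).trans_lt h1
  · intro h1
    rcases lt_or_ge ‖z‖ R with hz | hz
    · have h2 := norm_add_le z (mean a : ℂ)
      rw [Complex.norm_real, Real.norm_eq_abs] at h2
      linarith
    · obtain ⟨k, -, hk⟩ := h z hz h0
      obtain ⟨e1, -, e3⟩ := abs_norm_sub_int_mul_pi_le hk
      rw [him] at e3
      have hpi := Real.pi_gt_three
      have h2 : |k| ≤ N := abs_le_nat_of_mul_pi_lt (by linarith [(abs_le.1 e3).1])
      have h3 : ((|k| : ℤ) : ℝ) ≤ N := by exact_mod_cast h2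
      nlinarith [(abs_le.1 e1).2]

end Spectrum

/-! ### Matching the index n with the point πin. -/

section Numbering

/-- A member p with |p| > N would, by symmetry and convexity, bring in at least 2(N + 1) elements.
So S lies in the punctured interval, and equal cardinality finishes. -/
theorem eq_punctured_interval_of_encard {S : Set ℤ} {N : ℕ} (h0 : ∀ n ∈ S, n ≠ 0)
    (hsymm : ∀ n ∈ S, -n ∈ S) (hconv : ∀ m ∈ S, ∀ n ∈ S, ∀ p, m ≤ p → p ≤ n → p ≠ 0 → p ∈ S)
    (hcard : S.encard = 2 * N) (n : ℤ) : n ∈ S ↔ n ≠ 0 ∧ |n| ≤ N := by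
  classical
  have hcI : ∀ M : ℕ, ((Finset.Icc (-M : ℤ) M).erase 0).card = 2 * M := by
    intro M
    rw [Finset.card_erase_of_mem (by simp), Int.card_Icc]
    omega
  have hle : ∀ p ∈ S, |p| ≤ N := by
    intro p hp
    by_contra! hlt
    have hp' : |p| ∈ S := by
      rcases abs_choice p with h | h
      · rwa [h]
      · rw [h]; exact hsymm p hp
    have hsub : (((Finset.Icc (-(N + 1 : ℕ) : ℤ) (N + 1 : ℕ)).erase 0 : Finset ℤ) : Set ℤ) ⊆ S := by
      intro m hm
      rw [Finset.mem_coe, Finset.mem_erase, Finset.mem_Icc] at hm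
      push_cast at hm
      exact hconv _ (hsymm _ hp') _ hp' m (by omega) (by omega) hm.1
    have h1 := encard_le_encard hsub
    rw [encard_coe_eq_coe_finsetCard, hcI, hcard] at h1
    have h2 : 2 * (N + 1) ≤ 2 * N := by exact_mod_cast h1
    omega
  have hsub : S ⊆ (((Finset.Icc (-N : ℤ) N).erase 0 : Finset ℤ) : Set ℤ) := by
    intro p hp
    have h1 := abs_le.1 (hle p hp)
    rw [Finset.mem_coe, Finset.mem_erase, Finset.mem_Icc]
    exact ⟨h0 p hp, h1⟩
  have heq : S = (((Finset.Icc (-N : ℤ) N).erase 0 : Finset ℤ) : Set ℤ) := by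
    refine Finite.eq_of_subset_of_encard_le' ?_ hsub ?_
    · exact Finset.finite_toSet _
    · rw [encard_coe_eq_coe_finsetCard, hcI, hcard]
      push_cast
      exact le_rfl
  rw [heq]
  rw [Finset.mem_coe, Finset.mem_erase, Finset.mem_Icc, abs_le]

variable {a b : ℝ → ℝ} {lam : ℤ → ℂ}

theorem IsNumbering.abs_im_neg (h : IsNumbering a b lam) {n : ℤ} (hn : n ≠ 0) :
    |(lam (-n)).im| = |(lam n).im| := by
  by_cases h1 : (lam n).im = 0
  · by_cases h2 : (lam (-n)).im = 0
    · rw [h1, h2]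
    · have h3 := h.conj (-n) (neg_ne_zero.2 hn) h2
      rw [neg_neg] at h3
      rw [h3, Complex.conj_im, abs_neg]
  · rw [h.conj n hn h1, Complex.conj_im, abs_neg]

/-- The indices selected by the bound on |Im| form a symmetric set (conjugation) that is convex off
0 (ordering) and has 2N elements (Rouché). -/
theorem IsNumbering.abs_im_lt_iff (h : IsNumbering a b lam) (ha : ContDiffOn ℝ 2 a (Icc 0 1))
    (hb : ContDiffOn ℝ 2 b (Icc 0 1)) :
    ∃ N₀ : ℕ, ∀ N : ℕ, N₀ ≤ N → ∀ n : ℤ, n ≠ 0 →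
      (|(lam n).im| < Real.pi * (N + 1 / 2) ↔ |n| ≤ N) := by
  obtain ⟨⟨x, hx⟩, N₁, hN₁⟩ := zeroCount_charFun ha hb
  obtain ⟨N₂, hN₂⟩ := mem_ball_iff_abs_im_lt ha hb
  have hd := differentiable_charFun ha.continuousOn hb.continuousOn
  have hzero : ∀ n : ℤ, n ≠ 0 → charFun a b (lam n) = 0 := fun n hn =>
    (isEigenvalue_iff ha.continuousOn hb.continuousOn _).1 ((h.range_eq _).1 ⟨n, hn, rfl⟩)
  refine ⟨max N₁ N₂, fun N hN => ?_⟩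
  have hcard := encard_eq_zeroCount (s := {n : ℤ | n ≠ 0}) (c := -(mean a : ℂ))
    (R := Real.pi * (N + 1 / 2)) hd hx h.multiplicity
  rw [hN₁ N ((le_max_left _ _).trans hN)] at hcard
  have hS : {n : ℤ | n ∈ {n : ℤ | n ≠ 0} ∧ lam n ∈ ball (-(mean a : ℂ)) (Real.pi * (N + 1 / 2))} =
      {n : ℤ | n ≠ 0 ∧ |(lam n).im| < Real.pi * (N + 1 / 2)} := by
    ext n
    simp only [mem_ofPred_eq]
    exact and_congr_right fun hn => hN₂ N ((le_max_right _ _).trans hN) _ (hzero n hn)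
  rw [hS] at hcard
  push_cast at hcard
  have key := eq_punctured_interval_of_encard
    (S := {n : ℤ | n ≠ 0 ∧ |(lam n).im| < Real.pi * (N + 1 / 2)}) (fun n hn => hn.1)
    (fun n hn => ⟨neg_ne_zero.2 hn.1, by rw [h.abs_im_neg hn.1]; exact hn.2⟩)
    (fun m hm n hn p hmp hpn hp => ⟨hp, by
      have h1 := h.ordered m p hm.1 hp hmp
      have h2 := h.ordered p n hp hn.1 hpn
      have h3 := abs_lt.1 hm.2
      have h4 := abs_lt.1 hn.2
      exact abs_lt.2 ⟨by linarith [h3.1], by linarith [h4.2]⟩⟩) hcard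
  intro n hn
  have := key n
  simp only [mem_ofPred_eq, hn, ne_eq, not_false_eq_true, true_and] at this
  exact this

/-- The numbering is matched with `π i n` by the exact count. -/
theorem IsNumbering.norm_phase_sub_le (h : IsNumbering a b lam) (ha : ContDiffOn ℝ 2 a (Icc 0 1))
    (hb : ContDiffOn ℝ 2 b (Icc 0 1)) :
    ∃ C : ℝ, 0 < C ∧ ∃ N₀ : ℕ, ∀ n : ℤ, (N₀ : ℤ) < |n| →
      |(n : ℝ)| ≤ ‖lam n‖ ∧ ‖lam n + mean a - n * Real.pi * Complex.I‖ ≤ 1 / 4 ∧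
      ‖phase a b (lam n) - n * Real.pi * Complex.I‖ ≤ C / (n : ℝ) ^ 2 := by
  obtain ⟨C, R, hC, hR, hloc⟩ := exists_int_norm_sub_le ha hb
  obtain ⟨N₁, hN₁⟩ := h.abs_im_lt_iff ha hb
  obtain ⟨N₂, hN₂⟩ := exists_nat_le_pi_mul R
  refine ⟨C, hC, max N₁ N₂, fun n hn => ?_⟩
  have hn0 : n ≠ 0 := by
    rintro rfl
    rw [abs_zero] at hn
    omega
  -- The counts at N and N + 1 confine |Im λ_n| between π(N + 1/2) and π(N + 3/2), hence |k| = |n|.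
  obtain ⟨N, hN⟩ : ∃ N : ℕ, |n| = N + 1 := ⟨(|n| - 1).toNat, by
    have := Int.one_le_abs hn0
    omega⟩
  have hmax : max N₁ N₂ ≤ N := by omega
  have hlow : Real.pi * (N + 1 / 2) ≤ |(lam n).im| := by
    by_contra! hlt
    have := (hN₁ N ((le_max_left _ _).trans hmax) n hn0).1 hlt
    omega
  have hup : |(lam n).im| < Real.pi * ((N + 1 : ℕ) + 1 / 2) :=
    (hN₁ (N + 1) (((le_max_left _ _).trans hmax).trans (Nat.le_succ N)) n hn0).2 (by omega)
  push_cast at hup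
  have hpi := Real.pi_gt_three
  have hnorm := Complex.abs_im_le_norm (lam n)
  have hRz : R ≤ ‖lam n‖ := (hN₂ N ((le_max_right _ _).trans hmax)).trans (hlow.trans hnorm)
  have hnabs : |(n : ℝ)| = N + 1 := by
    rw [← Int.cast_abs, hN]; push_cast; rfl
  have hnz : |(n : ℝ)| ≤ ‖lam n‖ := by
    rw [hnabs]
    have : (0 : ℝ) ≤ N := N.cast_nonneg
    nlinarith
  have hzero : charFun a b (lam n) = 0 :=
    (isEigenvalue_iff ha.continuousOn hb.continuousOn _).1 ((h.range_eq _).1 ⟨n, hn0, rfl⟩)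
  obtain ⟨k, hk1, hk2⟩ := hloc _ hRz hzero
  obtain ⟨-, e2, e3⟩ := abs_norm_sub_int_mul_pi_le hk2
  rw [show (lam n + mean a).im = (lam n).im by simp] at e2 e3
  have e2' := abs_le.1 e2
  have e3' := abs_le.1 e3
  have hkabs : |k| = N + 1 := by
    apply le_antisymm
    · have := abs_le_nat_of_mul_pi_lt (k := k) (N := N + 1) (by rw [Nat.cast_succ]; linarith)
      exact_mod_cast this
    · by_contra! hlt
      have h1 : ((|k| : ℤ) : ℝ) ≤ N := by
        have : |k| ≤ (N : ℤ) := by omega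
        exact_mod_cast this
      nlinarith
  have him0 : (lam n).im ≠ 0 := by
    intro h1
    rw [h1, abs_zero] at hlow
    have : (0 : ℝ) ≤ N := N.cast_nonneg
    nlinarith
  have hconj := h.conj n hn0 him0
  -- Only the sign is left: λ_n and λ_{-n} are conjugate and ordered, so Im λ_n has the sign of n.
  have hkn : k = n := by
    have h1 : (lam (-n)).im = -(lam n).im := by rw [hconj, Complex.conj_im]
    have hk1' : (1 : ℝ) ≤ N + 1 := by
      have : (0 : ℝ) ≤ N := N.cast_nonneg
      linarith
    rcases lt_or_gt_of_ne hn0 with hneg | hpos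
    · have h2 := h.ordered n (-n) hn0 (neg_ne_zero.2 hn0) (by omega)
      have h3 : k ≤ 0 := by
        by_contra! hk
        have : (1 : ℝ) ≤ k := by exact_mod_cast hk
        nlinarith
      rw [abs_of_neg hneg] at hN
      rw [abs_of_nonpos h3] at hkabs
      omega
    · have h2 := h.ordered (-n) n (neg_ne_zero.2 hn0) hn0 (by omega)
      have h3 : 0 ≤ k := by
        by_contra! hk
        have : (k : ℝ) ≤ -1 := by exact_mod_cast Int.le_sub_one_of_lt hk
        nlinarith
      rw [abs_of_pos hpos] at hN
      rw [abs_of_nonneg h3] at hkabs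
      omega
  subst hkn
  refine ⟨hnz, hk2, hk1.trans ?_⟩
  have h0 : 0 < |(k : ℝ)| := by rw [hnabs]; positivity
  rw [← sq_abs (k : ℝ)]
  gcongr

end Numbering

/-! ### The two-term eigenvalue expansion and uniqueness of its coefficients. -/

section Expansion

theorem eventually_lt_abs (N : ℤ) : ∀ᶠ n : ℤ in atBot ⊔ atTop, N < |n| := by
  rw [eventually_sup]
  constructor
  · filter_upwards [eventually_lt_atBot (-N)] with n hn
    have := neg_le_abs n
    omega
  · filter_upwards [eventually_gt_atTop N] with n hn
    exact hn.trans_le (le_abs_self n)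

theorem IsNumbering.hasExpansion {a b : ℝ → ℝ} {lam : ℤ → ℂ} (h : IsNumbering a b lam)
    (ha : ContDiffOn ℝ 2 a (Icc 0 1)) (hb : ContDiffOn ℝ 2 b (Icc 0 1)) {c : ℕ → ℂ}
    (hc0 : c 0 = -(mean a : ℂ))
    (hc1 : c 1 = (mean (fun x => a x ^ 2 + b x) : ℂ) / (2 * Real.pi * Complex.I)) :
    HasExpansion lam 2 c := by
  obtain ⟨C, hC, N₀, hN₀⟩ := h.norm_phase_sub_le ha hb
  set q := mean (fun x => a x ^ 2 + b x) with hq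
  refine IsBigO.of_bound (C + |q| * (|mean a| + 1)) ?_
  filter_upwards [eventually_lt_abs N₀] with n hn
  obtain ⟨h1, h2, h3⟩ := hN₀ n hn
  have hn0 : n ≠ 0 := by
    rintro rfl
    rw [abs_zero] at hn
    omega
  have hnR : 0 < |(n : ℝ)| := abs_pos.2 (by exact_mod_cast hn0)
  have hnC : (n : ℂ) ≠ 0 := by exact_mod_cast hn0
  have hz0 : 0 < ‖lam n‖ := hnR.trans_le h1
  have hz : lam n ≠ 0 := norm_pos_iff.1 hz0
  have hpi : (Real.pi : ℂ) ≠ 0 := by exact_mod_cast Real.pi_ne_zero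
  -- Replacing 1/(2λ_n) by 1/(2πin) in the phase costs O(n⁻²), because λ_n - πin is bounded.
  have hid : lam n - (Real.pi * n * Complex.I + ∑ j ∈ Finset.range 2, c j * ((n : ℂ) ^ j)⁻¹) =
      (phase a b (lam n) - n * Real.pi * Complex.I) +
        -((q : ℂ) * (lam n - n * Real.pi * Complex.I) /
          (2 * (lam n * (Real.pi * n * Complex.I)))) := by
    have hI := Complex.I_ne_zero
    rw [Finset.sum_range_succ, Finset.sum_range_one, hc0, hc1, phase, ← hq]
    field_simp
    ring
  have hb1 : ‖lam n - n * Real.pi * Complex.I‖ ≤ |mean a| + 1 := by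
    have e1 : lam n - n * Real.pi * Complex.I =
        (lam n + mean a - n * Real.pi * Complex.I) - mean a := by ring
    have e2 := norm_sub_le (lam n + mean a - n * Real.pi * Complex.I) (mean a)
    rw [← e1, Complex.norm_real, Real.norm_eq_abs] at e2
    linarith
  have hb2 : ‖(q : ℂ) * (lam n - n * Real.pi * Complex.I) /
      (2 * (lam n * (Real.pi * n * Complex.I)))‖ ≤ |q| * (|mean a| + 1) / (n : ℝ) ^ 2 := by
    rw [norm_div, norm_mul, Complex.norm_real, Real.norm_eq_abs]
    apply div_le_div₀ (by positivity) (by gcongr) (by rw [← sq_abs]; positivity)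
    simp only [norm_mul, Complex.norm_ofNat, Complex.norm_real, Complex.norm_intCast,
      Complex.norm_I, Real.norm_eq_abs, abs_of_pos Real.pi_pos, mul_one]
    rw [← sq_abs]
    have e1 : |(n : ℝ)| * |(n : ℝ)| ≤ ‖lam n‖ * |(n : ℝ)| := by gcongr
    have e2 : 0 ≤ ‖lam n‖ * |(n : ℝ)| := by positivity
    nlinarith [Real.pi_gt_three]
  rw [hid]
  refine (norm_add_le _ _).trans ?_
  rw [norm_neg, Real.norm_of_nonneg (show 0 ≤ ((n : ℝ) ^ 2)⁻¹ by positivity), add_mul]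
  exact add_le_add (h3.trans_eq (div_eq_mul_inv _ _)) (hb2.trans_eq (div_eq_mul_inv _ _))

theorem HasExpansion.coeff_unique {lam : ℤ → ℂ} {c d : ℕ → ℂ} (hc : HasExpansion lam 2 c)
    (hd : HasExpansion lam 2 d) : c 0 = d 0 ∧ c 1 = d 1 := by
  have h1 : (fun n : ℤ => (d 0 - c 0) + (d 1 - c 1) * (n : ℂ)⁻¹) =O[atTop]
      (fun n : ℤ => ((n : ℝ) ^ 2)⁻¹) := by
    refine ((hc.sub hd).mono le_sup_right).congr_left fun n => ?_
    simp only [Finset.sum_range_succ, Finset.sum_range_zero]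
    ring
  have hinvR : Tendsto (fun n : ℤ => (n : ℝ)⁻¹) atTop (𝓝 0) :=
    tendsto_inv_atTop_zero.comp tendsto_intCast_atTop_atTop
  have hinv : Tendsto (fun n : ℤ => (n : ℂ)⁻¹) atTop (𝓝 0) := by
    have := (Complex.continuous_ofReal.tendsto 0).comp hinvR
    simpa [Function.comp_def] using this
  have hsq : Tendsto (fun n : ℤ => ((n : ℝ) ^ 2)⁻¹) atTop (𝓝 0) := by
    have := hinvR.pow 2
    simpa using this
  have e0 : d 0 - c 0 = 0 := by
    have t1 := h1.trans_tendsto hsq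
    have t2 : Tendsto (fun n : ℤ => (d 0 - c 0) + (d 1 - c 1) * (n : ℂ)⁻¹) atTop
        (𝓝 ((d 0 - c 0) + (d 1 - c 1) * 0)) :=
      tendsto_const_nhds.add (tendsto_const_nhds.mul hinv)
    simpa using tendsto_nhds_unique t2 t1
  have e1 : d 1 - c 1 = 0 := by
    rw [e0] at h1
    have h2 := (isBigO_refl (fun n : ℤ => (n : ℝ)) atTop).smul h1
    have t1 : Tendsto (fun n : ℤ => (n : ℝ) • (0 + (d 1 - c 1) * (n : ℂ)⁻¹)) atTop (𝓝 0) := by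
      refine h2.trans_tendsto (hinvR.congr' ?_)
      filter_upwards [eventually_gt_atTop 0] with n hn
      have : (n : ℝ) ≠ 0 := by exact_mod_cast hn.ne'
      rw [smul_eq_mul]
      field_simp
    have t2 : Tendsto (fun n : ℤ => (n : ℝ) • (0 + (d 1 - c 1) * (n : ℂ)⁻¹)) atTop
        (𝓝 (d 1 - c 1)) := by
      refine tendsto_const_nhds.congr' ?_
      filter_upwards [eventually_gt_atTop 0] with n hn
      have : (n : ℂ) ≠ 0 := by exact_mod_cast hn.ne'
      rw [Complex.real_smul, Complex.ofReal_intCast]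
      field_simp
      ring
    exact tendsto_nhds_unique t2 t1
  exact ⟨(sub_eq_zero.1 e0).symm, (sub_eq_zero.1 e1).symm⟩

end Expansion

/-! ### Constancy as vanishing variance. -/

section Mean

variable {a b : ℝ → ℝ}

theorem mean_congr {f g : ℝ → ℝ} (h : ∀ x ∈ Icc (0 : ℝ) 1, f x = g x) : mean f = mean g := by
  apply intervalIntegral.integral_congr
  rwa [uIcc_of_le zero_le_one]

theorem mean_const (k : ℝ) : mean (fun _ => k) = k := by simp [mean]

theorem mean_sq_add (ha : ContinuousOn a (Icc 0 1)) (hb : ContinuousOn b (Icc 0 1)) :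
    mean (fun x => a x ^ 2 + b x) = mean (fun x => a x ^ 2) + mean b := by
  rw [← uIcc_of_le (zero_le_one (α := ℝ))] at ha hb
  exact intervalIntegral.integral_add (ha.pow 2).intervalIntegrable hb.intervalIntegrable

theorem eq_mean_of_isConstant (h : IsConstant a) {x : ℝ} (hx : x ∈ Icc (0 : ℝ) 1) :
    a x = mean a := by
  obtain ⟨k, hk⟩ := h
  rw [mean_congr hk, mean_const, hk x hx]

/-- The equality case of Cauchy–Schwarz: ⟨a²⟩ - ⟨a⟩² is the integral of (a - ⟨a⟩)², a continuous
nonnegative function. -/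
theorem isConstant_iff_sq_mean (ha : ContinuousOn a (Icc 0 1)) :
    IsConstant a ↔ mean a ^ 2 = mean (fun x => a x ^ 2) := by
  constructor
  · rintro ⟨k, hk⟩
    rw [mean_congr hk, mean_const, mean_congr (g := fun _ => k ^ 2) fun x hx => by rw [hk x hx],
      mean_const]
  · intro h
    refine ⟨mean a, ?_⟩
    have hc : ContinuousOn (fun x => (a x - mean a) ^ 2) (Icc 0 1) := by fun_prop
    have hint : ∫ x in (0 : ℝ)..1, (a x - mean a) ^ 2 = 0 := by
      have ha' := ha
      rw [← uIcc_of_le (zero_le_one (α := ℝ))] at ha'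
      have e1 : ∀ x, (a x - mean a) ^ 2 = (a x ^ 2 - 2 * mean a * a x) + mean a ^ 2 := fun x => by
        ring
      simp_rw [e1]
      have i1 : IntervalIntegrable (fun x => a x ^ 2) MeasureTheory.volume 0 1 :=
        (ha'.pow 2).intervalIntegrable
      have i2 := (ha'.intervalIntegrable (μ := MeasureTheory.volume)).const_mul (2 * mean a)
      rw [intervalIntegral.integral_add (i1.sub i2) intervalIntegrable_const,
        intervalIntegral.integral_sub i1 i2, intervalIntegral.integral_const_mul]
      change mean (fun x => a x ^ 2) - 2 * mean a * mean a + _ = 0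
      rw [← h]
      simp
      ring
    by_contra! hcon
    obtain ⟨x, hx, hne⟩ := hcon
    have hpos := intervalIntegral.integral_pos zero_lt_one hc (fun x _ => sq_nonneg _)
      ⟨x, hx, (sq_nonneg _).lt_of_ne' (pow_ne_zero 2 (sub_ne_zero.2 hne))⟩
    exact hpos.ne' hint

end Mean

/-! ### Coefficients shared by pairs with common eigenvalues. -/

section Isospectral

variable {a b : ℝ → ℝ}

/-- If all zeros were small, two consecutive large discs would contain the same ones, yet the counts
are 2N and 2N + 2. -/
theorem exists_large_zero (ha : ContDiffOn ℝ 2 a (Icc 0 1)) (hb : ContDiffOn ℝ 2 b (Icc 0 1))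
    (r : ℝ) : ∃ z : ℂ, r ≤ ‖z‖ ∧ charFun a b z = 0 := by
  obtain ⟨-, N₀, hN₀⟩ := zeroCount_charFun ha hb
  obtain ⟨N₁, hN₁⟩ := exists_nat_le_pi_mul (|mean a| + r)
  by_contra! hcon
  set N := max N₀ N₁
  have h1 := hN₀ N (le_max_left _ _)
  have h2 := hN₀ (N + 1) ((le_max_left _ _).trans (Nat.le_succ N))
  have h3 : zeroCount (charFun a b) (-(mean a : ℂ)) (Real.pi * (N + 1 / 2)) =
      zeroCount (charFun a b) (-(mean a : ℂ)) (Real.pi * ((N + 1 : ℕ) + 1 / 2)) := by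
    apply finsum_mem_inter_support_eq'
    intro z hz
    have h0 := apply_eq_zero_of_analyticOrderNatAt_ne_zero hz
    have hzr : ‖z‖ < r := by
      by_contra! hle
      exact hcon z hle h0
    have h4 := norm_add_le z (mean a : ℂ)
    rw [Complex.norm_real, Real.norm_eq_abs] at h4
    have h5 := hN₁ N (le_max_right _ _)
    have h6 := hN₁ (N + 1) ((le_max_right _ _).trans (Nat.le_succ N))
    simp only [mem_ball, dist_eq_norm, sub_neg_eq_add]
    exact ⟨fun _ => by linarith, fun _ => by linarith⟩
  omega

theorem eq_zero_of_abs_le_div {x K : ℝ} (h : ∀ r : ℝ, ∃ s, r ≤ s ∧ 0 < s ∧ |x| ≤ K / s) :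
    x = 0 := by
  by_contra hx
  have hx0 : 0 < |x| := abs_pos.2 hx
  obtain ⟨s, h1, h2, h3⟩ := h (K / |x| + 1)
  rw [le_div_iff₀ h2] at h3
  have h4 : K / |x| < s := by linarith
  rw [div_lt_iff₀ hx0] at h4
  linarith

/-- Common large eigenvalues of two pairs determine the first two coefficients of the phase. -/
theorem means_eq_of_common_zeros {a' b' : ℝ → ℝ} (ha : ContDiffOn ℝ 2 a (Icc 0 1))
    (hb : ContDiffOn ℝ 2 b (Icc 0 1)) (ha' : ContDiffOn ℝ 2 a' (Icc 0 1))
    (hb' : ContDiffOn ℝ 2 b' (Icc 0 1))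
    (h : ∀ z, charFun a b z = 0 → charFun a' b' z = 0) :
    mean a = mean a' ∧
      mean (fun x => a x ^ 2 + b x) = mean (fun x => a' x ^ 2 + b' x) := by
  obtain ⟨C, R, hC, hR, hloc⟩ := exists_int_norm_phase_sub_le ha hb
  obtain ⟨C', R', hC', hR', hloc'⟩ := exists_int_norm_phase_sub_le ha' hb'
  set q := mean (fun x => a x ^ 2 + b x) with hq
  set q' := mean (fun x => a' x ^ 2 + b' x) with hq'
  have key : ∀ r : ℝ, ∃ z : ℂ, r ≤ ‖z‖ ∧ 1 ≤ ‖z‖ ∧ ∃ k : ℤ,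
      ‖((mean a - mean a' : ℝ) : ℂ) - ((q - q' : ℝ) : ℂ) / (2 * z) - k * Real.pi * Complex.I‖ ≤
        (C + C') / ‖z‖ ^ 2 := by
    intro r
    obtain ⟨z, hz, h0⟩ := exists_large_zero ha hb (max r (max R R'))
    have hzR : R ≤ ‖z‖ := ((le_max_left _ _).trans (le_max_right _ _)).trans hz
    have hzR' : R' ≤ ‖z‖ := ((le_max_right _ _).trans (le_max_right _ _)).trans hz
    obtain ⟨k, hk⟩ := hloc z hzR h0
    obtain ⟨k', hk'⟩ := hloc' z hzR' (h z h0)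
    refine ⟨z, (le_max_left _ _).trans hz, hR.trans hzR, k - k', ?_⟩
    have e : ((mean a - mean a' : ℝ) : ℂ) - ((q - q' : ℝ) : ℂ) / (2 * z) -
        ((k - k' : ℤ) : ℂ) * Real.pi * Complex.I =
        (phase a b z - k * Real.pi * Complex.I) - (phase a' b' z - k' * Real.pi * Complex.I) := by
      simp only [phase, ← hq, ← hq']
      push_cast
      ring
    rw [e, add_div]
    exact (norm_sub_le _ _).trans (add_le_add hk hk')
  -- Taking real parts removes the unknown kπi.
  have hmean : mean a - mean a' = 0 := by
    apply eq_zero_of_abs_le_div (K := C + C' + |q - q'|)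
    intro r
    obtain ⟨z, h1, h2, k, hk⟩ := key r
    have hz0 : 0 < ‖z‖ := by linarith
    refine ⟨‖z‖, h1, hz0, ?_⟩
    have e1 := (Complex.abs_re_le_norm _).trans hk
    have e2 : mean a - mean a' = (((mean a - mean a' : ℝ) : ℂ) - ((q - q' : ℝ) : ℂ) / (2 * z) -
        k * Real.pi * Complex.I).re + (((q - q' : ℝ) : ℂ) / (2 * z)).re := by
      simp
    have e3 : |(((q - q' : ℝ) : ℂ) / (2 * z)).re| ≤ |q - q'| / ‖z‖ := by
      refine (Complex.abs_re_le_norm _).trans ?_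
      rw [norm_div, norm_mul, Complex.norm_ofNat, Complex.norm_real, Real.norm_eq_abs]
      gcongr
      linarith
    have e4 : (C + C') / ‖z‖ ^ 2 ≤ (C + C') / ‖z‖ := by
      gcongr
      nlinarith
    rw [e2, add_div]
    exact (abs_add_le _ _).trans (add_le_add (e1.trans e4) e3)
  refine ⟨sub_eq_zero.1 hmean, sub_eq_zero.1 ?_⟩
  apply eq_zero_of_abs_le_div (K := 2 * (C + C'))
  intro r
  obtain ⟨z, h1, h2, k, hk⟩ := key (max r (C + C' + |q - q'|))
  have hz0 : 0 < ‖z‖ := by linarith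
  refine ⟨‖z‖, (le_max_left _ _).trans h1, hz0, ?_⟩
  rw [hmean, Complex.ofReal_zero, zero_sub] at hk
  have hbig := (le_max_right _ _).trans h1
  have e3 : ‖((q - q' : ℝ) : ℂ) / (2 * z)‖ = |q - q'| / (2 * ‖z‖) := by
    rw [norm_div, norm_mul, Complex.norm_ofNat, Complex.norm_real, Real.norm_eq_abs]
  have e4 : (C + C') / ‖z‖ ^ 2 ≤ (C + C') / ‖z‖ := by
    gcongr
    nlinarith
  -- With equal means every other term is O(1/|z|), too small to match a nonzero multiple of π.
  -- Multiplying what remains by |z| then isolates q - q'.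
  have hk0 : k = 0 := by
    by_contra hkne
    have f1 : ‖(k * Real.pi * Complex.I : ℂ)‖ = |k| * Real.pi := by
      simp [abs_of_pos Real.pi_pos]
    have f2 : (1 : ℝ) ≤ ((|k| : ℤ) : ℝ) := by exact_mod_cast Int.one_le_abs hkne
    have f3 : ‖(k * Real.pi * Complex.I : ℂ)‖ ≤ (C + C') / ‖z‖ + |q - q'| / ‖z‖ := by
      have f4 : (k * Real.pi * Complex.I : ℂ) =
          -(-(((q - q' : ℝ) : ℂ) / (2 * z)) - k * Real.pi * Complex.I) -
            ((q - q' : ℝ) : ℂ) / (2 * z) := by ring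
      have f5 : |q - q'| / (2 * ‖z‖) ≤ |q - q'| / ‖z‖ := by
        gcongr
        linarith
      rw [f4]
      refine (norm_sub_le _ _).trans ?_
      rw [norm_neg, e3]
      exact add_le_add (hk.trans e4) f5
    rw [f1, ← add_div, le_div_iff₀ hz0] at f3
    nlinarith [Real.pi_gt_three, mul_le_mul f2 Real.pi_gt_three.le (by norm_num) (by linarith)]
  rw [hk0, Int.cast_zero, zero_mul, zero_mul, sub_zero, norm_neg, e3,
    div_le_div_iff₀ (by positivity) (by positivity)] at hk
  rw [le_div_iff₀ hz0]
  have : |q - q'| * ‖z‖ * ‖z‖ ≤ 2 * (C + C') * ‖z‖ := by nlinarith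
  exact le_of_mul_le_mul_right this hz0

end Isospectral

end DampedWave

theorem corollary2 (a b : ℝ → ℝ)
    (ha : ContDiffOn ℝ 3 a (Set.Icc 0 1)) (hb : ContDiffOn ℝ 2 b (Set.Icc 0 1)) :
    (∀ lam : ℤ → ℂ, DampedWave.IsNumbering a b lam →
      (∃ c : ℕ → ℂ, DampedWave.HasExpansion lam 2 c) ∧
      ∀ c : ℕ → ℂ, DampedWave.HasExpansion lam 2 c →
        (DampedWave.IsConstant a ↔
          c 0 ^ 2 = 2 * (Real.pi : ℂ) * Complex.I * c 1 - (DampedWave.mean b : ℂ)) ∧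
        (DampedWave.IsConstant a → ∀ x ∈ Set.Icc (0 : ℝ) 1, (a x : ℂ) = -c 0)) ∧
    (∀ α : ℝ,
      (∀ z : ℂ, DampedWave.IsEigenvalue a b z ↔ DampedWave.IsEigenvalue (fun _ => α) b z) →
      ∀ x ∈ Set.Icc (0 : ℝ) 1, a x = α) := by
  have ha2 : ContDiffOn ℝ 2 a (Set.Icc 0 1) := ha.of_le (by norm_num)
  have hac := ha.continuousOn
  have hbc := hb.continuousOn
  refine ⟨fun lam hlam => ?_, fun α hα x hx => ?_⟩
  -- Only `d 0` and `d 1` enter the expansion; the values at j ≥ 2 are arbitrary.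
  · let d : ℕ → ℂ := fun j => if j = 0 then -(DampedWave.mean a : ℂ) else
      (DampedWave.mean (fun x => a x ^ 2 + b x) : ℂ) / (2 * Real.pi * Complex.I)
    have hd : DampedWave.HasExpansion lam 2 d := hlam.hasExpansion ha2 hb rfl rfl
    refine ⟨⟨d, hd⟩, fun c hc => ?_⟩
    obtain ⟨h0, h1⟩ := hc.coeff_unique hd
    have h0' : c 0 = -(DampedWave.mean a : ℂ) := h0
    have h1' : 2 * (Real.pi : ℂ) * Complex.I * c 1 =
        (DampedWave.mean (fun x => a x ^ 2 + b x) : ℂ) := by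
      rw [h1]
      exact mul_div_cancel₀ _ Complex.two_pi_I_ne_zero
    refine ⟨?_, fun hconst x hx => ?_⟩
    · rw [DampedWave.isConstant_iff_sq_mean hac, h1', h0', DampedWave.mean_sq_add hac hbc]
      push_cast
      rw [add_sub_cancel_right, neg_sq]
      norm_cast
    · rw [h0', neg_neg, DampedWave.eq_mean_of_isConstant hconst hx]
  · have hα2 : ContDiffOn ℝ 2 (fun _ : ℝ => α) (Set.Icc 0 1) := contDiffOn_const
    -- Inclusion of the first spectrum in the second suffices here.
    obtain ⟨h1, h2⟩ := DampedWave.means_eq_of_common_zeros ha2 hb hα2 hb fun z hz =>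
      (DampedWave.isEigenvalue_iff hα2.continuousOn hbc z).1
        ((hα z).1 ((DampedWave.isEigenvalue_iff hac hbc z).2 hz))
    rw [DampedWave.mean_const] at h1
    rw [DampedWave.mean_sq_add hac hbc, DampedWave.mean_sq_add hα2.continuousOn hbc,
      DampedWave.mean_const, add_left_inj] at h2
    have hconst : DampedWave.IsConstant a :=
      (DampedWave.isConstant_iff_sq_mean hac).2 (by rw [h1, h2])
    rw [DampedWave.eq_mean_of_isConstant hconst hx, h1]
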